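/- Let $n_+,n_-\ge 1$ and $n=n_++n_-$. Let $\lambda_1,\dots,\lambda_{n_+}:[0,\infty)\to(0,\infty)$ and $\theta_1,\dots,\theta_{n_-}:[0,\infty)\to(-\infty,0)$ be continuous and bounded. Put $\Lambda=\operatorname{diag}(\lambda_k)$, $\Theta=\operatorname{diag}(\theta_j)$, $\Delta=\operatorname{diag}(\Lambda,\Theta)$, and let $X=L^2_{|\Delta|}(0,\infty)$ be the Hilbert space of measurable $x=(x_+,x_-):[0,\infty)\to\mathbb C^{n_+}\times\mathbb C^{n_-}$ with $\|x\|^2=\int_0^\infty x(\xi)^*|\Delta(\xi)|x(\xi)\,d\xi<\infty$. On $$D=D(\mathcal A)=D(\mathcal B)=D(\mathcal C)=\{x\in X:\ \Delta x\in AC_{\rm loc}[0,\infty),\ (\Delta x)'\in X\}$$ define $\mathcal Ax=(\Delta x)'$, $\mathcal Bx=(\Theta x_-)(0)\in\mathbb C^{n_-}$ and $\mathcal Cx=(\Lambda x_+)(0)\in\mathbb C^{n_+}$. Consider the system $\dot x=\mathcal Ax$, $u=\mathcal Bx$, $y=\mathcal Cx$, and let $A$ be the restriction of $\mathcal A$ to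 $D\cap\ker\mathcal B$. A classical solution on $[0,\tau]$ is a function $x\in C^1([0,\tau],X)$ with values in $D$ that satisfies these equations for all $t\in[0,\tau]$. Then: 1. The system is a boundary control system, i.e. $A$ generates a $C_0$-semigroup on $X$; there is a bounded linear $B:\mathbb C^{n_-}\to X$ with values in $D$ such that $\mathcal AB$ is bounded and $\mathcal BBu=u$ for all $u$; and $\mathcal C$ is bounded on $D(A)$ with respect to the graph norm of $A$. 2. The system is well-posed: for every $\tau>0$ there is $m_\tau>0$ such that for all $x_0\in D$ and all $u\in C^2([0,\tau],\mathbb C^{n_-})$ with $u(0)=\mathcal Bx_0$ there is a unique classical solution $x$ on $[0,\tau]$ with input $u$ and $x(0)=x_0$, and its output $y=\mathcal Cx$ satisfies $$\|x(\tau)\|^2+\int_0^\tau\|y(t)\|^2\,dt\le m_\tau\Big(\|x_0\|^2+\int_0^\tau\|u(t)\|^2\,dt\Big).$$ 3. Every classical solution satisfies the energy balance $\frac{d}{dt}\|x(t)\|^2=\|u(t)\|^2-\|y(t)\|^2$. 4. The transfer function is zero: every $s\in\mathbb C$ with $\operatorname{Re}s>0$ belongs to the resolvent set $\rho(A)$,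 and for every $B$ as in 1 and every $s\in\rho(A)$, $$G(s)=\mathcal C(s-A)^{-1}(\mathcal AB-sB)+\mathcal CB=0.$$ -/

import Mathlib

open MeasureTheory Set Filter Topology

noncomputable section

/-! ## Semigroups, generators, resolvents of partially defined operators -/

/-- `(T t)_{t ≥ 0}` is a `C₀`-semigroup of bounded operators on `X`
(values of `T` at negative times are irrelevant). -/
structure IsC0Semigroup {X : Type*} [NormedAddCommGroup X] [NormedSpace ℂ X]
    (T : ℝ → X →L[ℂ] X) : Prop where
  map_zero : T 0 = ContinuousLinearMap.id ℂ X
  map_add : ∀ s t : ℝ, 0 ≤ s → 0 ≤ t → T (s + t) = (T s).comp (T t)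
  strongly_continuous : ∀ x : X, Tendsto (fun t : ℝ => T t x) (𝓝[>] 0) (𝓝 x)

/-- `A` is the generator of the `C₀`-semigroup `T`: one has `x ∈ D(A)` and `A x = y` if and only if
the difference quotients `(T t x - x) / t` converge to `y` as `t ↓ 0`. -/
def IsGeneratorOf {X : Type*} [NormedAddCommGroup X] [NormedSpace ℂ X]
    (A : X →ₗ.[ℂ] X) (T : ℝ → X →L[ℂ] X) : Prop :=
  ∀ x y : X, (x, y) ∈ A.graph ↔
    Tendsto (fun t : ℝ => ((t : ℂ)⁻¹) • (T t x - x)) (𝓝[>] 0) (𝓝 y)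

/-- `A` generates a `C₀`-semigroup on `X`. -/
def GeneratesC0Semigroup {X : Type*} [NormedAddCommGroup X] [NormedSpace ℂ X]
    (A : X →ₗ.[ℂ] X) : Prop :=
  ∃ T : ℝ → X →L[ℂ] X, IsC0Semigroup T ∧ IsGeneratorOf A T

/-- `R = (s - A)⁻¹`: `R` is a bounded operator on `X` with values in `D(A)` that is a two-sided
inverse of `s - A : D(A) → X`. -/
def IsResolventAt {X : Type*} [NormedAddCommGroup X] [NormedSpace ℂ X]
    (A : X →ₗ.[ℂ] X) (s : ℂ) (R : X →L[ℂ] X) : Prop :=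
  (∀ y : X, ∃ h : R y ∈ A.domain, s • R y - A ⟨R y, h⟩ = y) ∧
    ∀ x : A.domain, R (s • (x : X) - A x) = x

/-- The resolvent set `ρ(A)`. -/
def unboundedResolventSet {X : Type*} [NormedAddCommGroup X] [NormedSpace ℂ X]
    (A : X →ₗ.[ℂ] X) : Set ℂ :=
  {s | ∃ R : X →L[ℂ] X, IsResolventAt A s R}

/-- The resolvent operator `(s - A)⁻¹` for `s ∈ ρ(A)`. -/
def resolventAt {X : Type*} [NormedAddCommGroup X] [NormedSpace ℂ X]
    (A : X →ₗ.[ℂ] X) (s : ℂ) (hs : s ∈ unboundedResolventSet A) : X →L[ℂ] X :=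
  hs.choose

theorem resolventAt_mem {X : Type*} [NormedAddCommGroup X] [NormedSpace ℂ X]
    (A : X →ₗ.[ℂ] X) (s : ℂ) (hs : s ∈ unboundedResolventSet A) (y : X) :
    resolventAt A s hs y ∈ A.domain :=
  (hs.choose_spec.1 y).choose

/-! ## Abstract boundary control systems -/

/-- The data `ẋ = 𝒜 x`, `u = ℬ x`, `y = 𝒞 x` with state space `X`, input space `U` and output
space `Y`: linear operators `𝒜 : D(𝒜) ⊆ X → X`, `ℬ : D(ℬ) ⊆ X → U`, `𝒞 : D(𝒜) → Y` such that
`D(𝒜) ⊆ D(ℬ)`. -/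
structure BoundarySystem (X U Y : Type*)
    [NormedAddCommGroup X] [InnerProductSpace ℂ X] [CompleteSpace X]
    [NormedAddCommGroup U] [InnerProductSpace ℂ U] [CompleteSpace U]
    [NormedAddCommGroup Y] [InnerProductSpace ℂ Y] [CompleteSpace Y] where
  opA : X →ₗ.[ℂ] X
  opB : X →ₗ.[ℂ] U
  domain_le : opA.domain ≤ opB.domain
  opC : opA.domain →ₗ[ℂ] Y

namespace BoundarySystem

variable {X U Y : Type*}
  [NormedAddCommGroup X] [InnerProductSpace ℂ X] [CompleteSpace X]
  [NormedAddCommGroup U] [InnerProductSpace ℂ U] [CompleteSpace U]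
  [NormedAddCommGroup Y] [InnerProductSpace ℂ Y] [CompleteSpace Y]

/-- The operator `A`: the restriction of `𝒜` to `D(A) = D(𝒜) ∩ ker ℬ`. -/
def restrictedOp (S : BoundarySystem X U Y) : X →ₗ.[ℂ] X :=
  S.opA.domRestrict ((LinearMap.ker S.opB.toFun).map S.opB.domain.subtype)

theorem restrictedOp_domain_le (S : BoundarySystem X U Y) : S.restrictedOp.domain ≤ S.opA.domain :=
  inf_le_right

/-- A bounded operator `B : U → X` with values in `D(𝒜)` such that `𝒜 B` is bounded and
`ℬ B u = u` for all `u`. -/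
structure Lifting (S : BoundarySystem X U Y) where
  op : U →L[ℂ] X
  mem : ∀ u : U, op u ∈ S.opA.domain
  bounded : ∃ K : ℝ, ∀ u : U, ‖S.opA ⟨op u, mem u⟩‖ ≤ K * ‖u‖
  right_inv : ∀ u : U, S.opB ⟨op u, S.domain_le (mem u)⟩ = u

/-- `Σ` is a boundary control system: `A` generates a `C₀`-semigroup on `X`, there is a lifting
`B`, and `𝒞` is bounded on `D(A)` with respect to the graph norm of `A`. -/
structure IsBoundaryControlSystem (S : BoundarySystem X U Y) : Prop where
  generates : GeneratesC0Semigroup S.restrictedOp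
  lifting : Nonempty S.Lifting
  output_bounded : ∃ K : ℝ, ∀ x : S.restrictedOp.domain,
    ‖S.opC ⟨x, S.restrictedOp_domain_le x.2⟩‖ ≤ K * (‖(x : X)‖ + ‖S.restrictedOp x‖)

/-- `x` is a classical solution on `[0, τ]` of the system with input `u`, initial value `x₀` and
output `y`: `x ∈ C¹([0, τ], X)`, `x(0) = x₀`, and for all `t ∈ [0, τ]` one has `x(t) ∈ D(𝒜)`,
`ẋ(t) = 𝒜 x(t)`, `ℬ x(t) = u(t)` and `𝒞 x(t) = y(t)`. -/
structure IsClassicalSolution (S : BoundarySystem X U Y) (τ : ℝ) (x₀ : X) (u : ℝ → U)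
    (x : ℝ → X) (y : ℝ → Y) : Prop where
  initial : x 0 = x₀
  contDiffOn : ContDiffOn ℝ 1 x (Icc 0 τ)
  equations : ∀ t ∈ Icc 0 τ, ∃ h : x t ∈ S.opA.domain,
    HasDerivWithinAt x (S.opA ⟨x t, h⟩) (Icc 0 τ) t ∧
    S.opB ⟨x t, S.domain_le h⟩ = u t ∧
    S.opC ⟨x t, h⟩ = y t

/-- Well-posedness: for every `τ > 0` there is `m > 0` such that for all `x₀ ∈ D(𝒜)` and all
`u ∈ C²([0, τ], U)` with `u(0) = ℬ x₀` there is a unique classical solution on `[0, τ]`, and it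
satisfies `‖x(τ)‖² + ∫₀^τ ‖y‖² ≤ m (‖x₀‖² + ∫₀^τ ‖u‖²)` (with `‖y‖²` integrable, so that the
integral is not a default value). -/
def WellPosed (S : BoundarySystem X U Y) : Prop :=
  ∀ τ : ℝ, 0 < τ → ∃ m : ℝ, 0 < m ∧
    ∀ (x₀ : S.opA.domain) (u : ℝ → U), ContDiffOn ℝ 2 u (Icc 0 τ) →
      u 0 = S.opB ⟨x₀, S.domain_le x₀.2⟩ →
      ∃ (x : ℝ → X) (y : ℝ → Y), S.IsClassicalSolution τ x₀ u x y ∧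
        (∀ (x' : ℝ → X) (y' : ℝ → Y), S.IsClassicalSolution τ x₀ u x' y' →
          EqOn x' x (Icc 0 τ)) ∧
        IntervalIntegrable (fun t => ‖y t‖ ^ 2) volume 0 τ ∧
        ‖x τ‖ ^ 2 + ∫ t in (0 : ℝ)..τ, ‖y t‖ ^ 2 ≤
          m * (‖(x₀ : X)‖ ^ 2 + ∫ t in (0 : ℝ)..τ, ‖u t‖ ^ 2)

/-- The energy balance `d/dt ‖x(t)‖² = ‖u(t)‖² - ‖y(t)‖²` along every classical solution. -/
def EnergyBalance (S : BoundarySystem X U Y) : Prop :=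
  ∀ (τ : ℝ) (x₀ : X) (u : ℝ → U) (x : ℝ → X) (y : ℝ → Y), 0 < τ →
    S.IsClassicalSolution τ x₀ u x y → ∀ t ∈ Icc 0 τ,
      HasDerivWithinAt (fun r => ‖x r‖ ^ 2) (‖u t‖ ^ 2 - ‖y t‖ ^ 2) (Icc 0 τ) t

/-- The value `G(s) = 𝒞 (s - A)⁻¹ (𝒜 B - s B) + 𝒞 B` of the transfer function at `s ∈ ρ(A)`,
formed with the lifting `B`. -/
def transferFunction (S : BoundarySystem X U Y) (B : S.Lifting) (s : ℂ)
    (hs : s ∈ unboundedResolventSet S.restrictedOp) (u : U) : Y :=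
  S.opC ⟨resolventAt S.restrictedOp s hs (S.opA ⟨B.op u, B.mem u⟩ - s • B.op u),
      S.restrictedOp_domain_le (resolventAt_mem S.restrictedOp s hs _)⟩ +
    S.opC ⟨B.op u, B.mem u⟩

end BoundarySystem

/-! ## The diagonal system on the half-line -/

/-- The diagonal entries of `Δ = diag(Λ, Θ)` on `[0, ∞)`: continuous `λ₁, …, λ_p > 0` and
continuous `θ₁, …, θ_m < 0` (values at negative arguments are irrelevant). -/
structure SignedDiagonal (p m : ℕ) where
  lam : Fin p → ℝ → ℝ
  theta : Fin m → ℝ → ℝ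
  lam_continuousOn : ∀ k, ContinuousOn (lam k) (Ici 0)
  theta_continuousOn : ∀ j, ContinuousOn (theta j) (Ici 0)
  lam_pos : ∀ k, ∀ ξ : ℝ, 0 ≤ ξ → 0 < lam k ξ
  theta_neg : ∀ j, ∀ ξ : ℝ, 0 ≤ ξ → theta j ξ < 0

/-- The measure `|w(ξ)| dξ` on `[0, ∞)`. -/
def weightedMeasure (w : ℝ → ℝ) : Measure ℝ :=
  (volume.restrict (Ici 0)).withDensity (fun ξ => ENNReal.ofReal |w ξ|)

/-- `f` is locally absolutely continuous on `[0, ∞)`. -/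
def LocallyAbsolutelyContinuous (f : ℝ → ℂ) : Prop :=
  ∀ a b : ℝ, 0 ≤ a → a ≤ b → AbsolutelyContinuousOnInterval f a b

theorem LocallyAbsolutelyContinuous.continuousOn {f : ℝ → ℂ}
    (hf : LocallyAbsolutelyContinuous f) : ContinuousOn f (Ici 0) := by
  intro x hx
  have hx : (0 : ℝ) ≤ x := hx
  have h := (hf 0 (x + 1) le_rfl (by linarith)).continuousOn
  rw [uIcc_of_le (by linarith : (0 : ℝ) ≤ x + 1)] at h
  refine (h x ⟨hx, by linarith⟩).mono_of_mem_nhdsWithin ?_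
  rw [← Ici_inter_Iic]
  exact inter_mem_nhdsWithin _ (Iic_mem_nhds (by linarith))

theorem ae_weightedMeasure {w : ℝ → ℝ} (hw : ContinuousOn w (Ici 0))
    (h0 : ∀ ξ : ℝ, 0 ≤ ξ → w ξ ≠ 0) :
    ae (weightedMeasure w) = ae (volume.restrict (Ici (0 : ℝ))) := by
  apply le_antisymm
  · exact (withDensity_absolutelyContinuous _ _).ae_le
  · refine (withDensity_absolutelyContinuous' ?_ ?_).ae_le
    · exact (hw.abs.aemeasurable measurableSet_Ici).ennreal_ofReal
    · filter_upwards [ae_restrict_mem measurableSet_Ici] with ξ hξ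
      simpa using h0 ξ hξ

namespace SignedDiagonal

variable {p m : ℕ} (D : SignedDiagonal p m)

/-- The diagonal entries of `Δ`, the `λ`'s first. -/
def entry : Fin p ⊕ Fin m → ℝ → ℝ := Sum.elim D.lam D.theta

theorem entry_continuousOn (i : Fin p ⊕ Fin m) : ContinuousOn (D.entry i) (Ici 0) := by
  rcases i with k | j
  · exact D.lam_continuousOn k
  · exact D.theta_continuousOn j

theorem entry_ne_zero (i : Fin p ⊕ Fin m) (ξ : ℝ) (hξ : 0 ≤ ξ) : D.entry i ξ ≠ 0 := by
  rcases i with k | j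
  · exact (D.lam_pos k ξ hξ).ne'
  · exact (D.theta_neg j ξ hξ).ne

/-- The Hilbert space `L²_{|Δ|}(0, ∞)` of (classes of) measurable `x : [0, ∞) → ℂⁿ` such that
`‖x‖² = ∫ x(ξ)* |Δ(ξ)| x(ξ) dξ = ∑ᵢ ∫ |Δᵢ(ξ)| |xᵢ(ξ)|² dξ` is finite, as the orthogonal sum of the
weighted `L²`-spaces of the coordinates. -/
abbrev State : Type :=
  PiLp 2 (fun i : Fin p ⊕ Fin m => Lp ℂ 2 (weightedMeasure (D.entry i)))

/-- `f` is the locally absolutely continuous representative of `Δ x`, and its almost everywhere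
derivative is `z`, i.e. `z = (Δ x)'`. -/
structure IsRepresentative (x : D.State) (f : Fin p ⊕ Fin m → ℝ → ℂ) (z : D.State) : Prop where
  absCont : ∀ i, LocallyAbsolutelyContinuous (f i)
  eq_mul : ∀ i, ∀ᵐ ξ ∂(volume.restrict (Ici (0 : ℝ))), f i ξ = (D.entry i ξ : ℂ) * x i ξ
  hasDerivAt : ∀ i, ∀ᵐ ξ ∂(volume.restrict (Ici (0 : ℝ))), HasDerivAt (f i) (z i ξ) ξ

variable {D}

theorem ae_of_ae (i : Fin p ⊕ Fin m) {q : ℝ → Prop}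
    (h : ∀ᵐ ξ ∂(weightedMeasure (D.entry i)), q ξ) :
    ∀ᵐ ξ ∂(volume.restrict (Ici (0 : ℝ))), q ξ := by
  rwa [ae_weightedMeasure (D.entry_continuousOn i) (D.entry_ne_zero i)] at h

namespace IsRepresentative

theorem zero : D.IsRepresentative 0 0 0 where
  absCont i a b _ _ := by
    exact (contDiff_const (c := (0 : ℂ))).contDiffOn.absolutelyContinuousOnInterval
  eq_mul i := by
    filter_upwards [ae_of_ae i (Lp.coeFn_zero ℂ 2 (weightedMeasure (D.entry i)))] with ξ h
    simp only [PiLp.zero_apply, h]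
    simp
  hasDerivAt i := by
    filter_upwards [ae_of_ae i (Lp.coeFn_zero ℂ 2 (weightedMeasure (D.entry i)))] with ξ h
    simp only [PiLp.zero_apply, h]
    exact hasDerivAt_const ξ (0 : ℂ)

theorem add {x x' z z' : D.State} {f f' : Fin p ⊕ Fin m → ℝ → ℂ}
    (h : D.IsRepresentative x f z) (h' : D.IsRepresentative x' f' z') :
    D.IsRepresentative (x + x') (f + f') (z + z') where
  absCont i a b ha hb := (h.absCont i a b ha hb).add (h'.absCont i a b ha hb)
  eq_mul i := by
    filter_upwards [h.eq_mul i, h'.eq_mul i, ae_of_ae i (Lp.coeFn_add (x i) (x' i))]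
      with ξ h1 h2 h3
    simp only [PiLp.add_apply, h3, Pi.add_apply, h1, h2]
    ring
  hasDerivAt i := by
    filter_upwards [h.hasDerivAt i, h'.hasDerivAt i, ae_of_ae i (Lp.coeFn_add (z i) (z' i))]
      with ξ h1 h2 h3
    simp only [PiLp.add_apply, h3, Pi.add_apply]
    exact h1.add h2

theorem smul {x z : D.State} {f : Fin p ⊕ Fin m → ℝ → ℂ}
    (c : ℂ) (h : D.IsRepresentative x f z) :
    D.IsRepresentative (c • x) (c • f) (c • z) where
  absCont i a b ha hb := (h.absCont i a b ha hb).const_smul c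
  eq_mul i := by
    filter_upwards [h.eq_mul i, ae_of_ae i (Lp.coeFn_smul c (x i))] with ξ h1 h3
    simp only [PiLp.smul_apply, h3, Pi.smul_apply, h1, smul_eq_mul]
    ring
  hasDerivAt i := by
    filter_upwards [h.hasDerivAt i, ae_of_ae i (Lp.coeFn_smul c (z i))] with ξ h1 h3
    simp only [PiLp.smul_apply, h3, Pi.smul_apply]
    exact h1.const_smul c

/-- The continuous representative of `Δ x` is unique on `[0, ∞)`. -/
theorem eqOn {x z z' : D.State} {f f' : Fin p ⊕ Fin m → ℝ → ℂ}
    (h : D.IsRepresentative x f z) (h' : D.IsRepresentative x f' z') (i : Fin p ⊕ Fin m) :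
    EqOn (f i) (f' i) (Ici 0) := by
  refine Measure.eqOn_of_ae_eq (μ := volume) ?_ (h.absCont i).continuousOn
    (h'.absCont i).continuousOn ?_
  · filter_upwards [h.eq_mul i, h'.eq_mul i] with ξ h1 h2
    rw [h1, h2]
  · simp

/-- The derivative `(Δ x)'` is unique. -/
theorem deriv_eq {x z z' : D.State} {f f' : Fin p ⊕ Fin m → ℝ → ℂ}
    (h : D.IsRepresentative x f z) (h' : D.IsRepresentative x f' z') : z = z' := by
  ext i : 1
  apply Lp.ext
  have key : ∀ᵐ ξ ∂(volume.restrict (Ici (0 : ℝ))), z i ξ = z' i ξ := by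
    have hpos : ∀ᵐ ξ ∂(volume.restrict (Ici (0 : ℝ))), ξ ∈ Ioi (0 : ℝ) := by
      rw [← restrict_Ioi_eq_restrict_Ici]
      exact ae_restrict_mem measurableSet_Ioi
    filter_upwards [h.hasDerivAt i, h'.hasDerivAt i, hpos] with ξ h1 h2 h3
    refine h1.unique (h2.congr_of_eventuallyEq ?_)
    filter_upwards [Ioi_mem_nhds h3] with η hη
    exact h.eqOn h' i (le_of_lt (mem_Ioi.1 hη))
  have hae := ae_weightedMeasure (D.entry_continuousOn i) (D.entry_ne_zero i)
  change ∀ᵐ ξ ∂(weightedMeasure (D.entry i)), z i ξ = z' i ξ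
  rwa [hae]

end IsRepresentative

variable (D)

/-- `{x ∈ L²_{|Δ|} : Δ x ∈ AC_loc[0, ∞) and (Δ x)' ∈ L²_{|Δ|}}`. -/
def domain : Submodule ℂ D.State where
  carrier := {x | ∃ f z, D.IsRepresentative x f z}
  add_mem' := by
    rintro x x' ⟨f, z, h⟩ ⟨f', z', h'⟩
    exact ⟨_, _, h.add h'⟩
  zero_mem' := ⟨_, _, IsRepresentative.zero⟩
  smul_mem' := by
    rintro c x ⟨f, z, h⟩
    exact ⟨_, _, h.smul c⟩

/-- The locally absolutely continuous representative of `Δ x`. -/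
def rep (x : D.domain) : Fin p ⊕ Fin m → ℝ → ℂ := x.2.choose

/-- The element `(Δ x)'` of `L²_{|Δ|}`. -/
def derivative (x : D.domain) : D.State := x.2.choose_spec.choose

theorem isRepresentative (x : D.domain) : D.IsRepresentative x (D.rep x) (D.derivative x) :=
  x.2.choose_spec.choose_spec

theorem rep_add_zero (x x' : D.domain) (i : Fin p ⊕ Fin m) :
    D.rep (x + x') i 0 = D.rep x i 0 + D.rep x' i 0 :=
  (D.isRepresentative (x + x')).eqOn ((D.isRepresentative x).add (D.isRepresentative x')) i
    self_mem_Ici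

theorem rep_smul_zero (c : ℂ) (x : D.domain) (i : Fin p ⊕ Fin m) :
    D.rep (c • x) i 0 = c * D.rep x i 0 :=
  (D.isRepresentative (c • x)).eqOn ((D.isRepresentative x).smul c) i self_mem_Ici

/-- The system `𝒜 x = (Δ x)'`, `ℬ x = (Θ x₋)(0)`, `𝒞 x = (Λ x₊)(0)` with
`D(𝒜) = D(ℬ) = D(𝒞) = {x ∈ L²_{|Δ|} : Δ x ∈ AC_loc[0, ∞) and (Δ x)' ∈ L²_{|Δ|}}`. -/
def system : BoundarySystem D.State (EuclideanSpace ℂ (Fin m)) (EuclideanSpace ℂ (Fin p)) where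
  opA :=
    { domain := D.domain
      toFun :=
        { toFun := D.derivative
          map_add' := fun x x' => (D.isRepresentative (x + x')).deriv_eq
            ((D.isRepresentative x).add (D.isRepresentative x'))
          map_smul' := fun c x => (D.isRepresentative (c • x)).deriv_eq
            ((D.isRepresentative x).smul c) } }
  opB :=
    { domain := D.domain
      toFun :=
        { toFun := fun x => WithLp.toLp 2 (fun j : Fin m => D.rep x (Sum.inr j) 0)
          map_add' := fun x x' => by
            ext j
            exact D.rep_add_zero x x' (Sum.inr j)
          map_smul' := fun c x => by
            ext j
            exact D.rep_smul_zero c x (Sum.inr j) } }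
  domain_le := le_rfl
  opC :=
    { toFun := fun x => WithLp.toLp 2 (fun k : Fin p => D.rep x (Sum.inl k) 0)
      map_add' := fun x x' => by
        ext k
        exact D.rep_add_zero x x' (Sum.inl k)
      map_smul' := fun c x => by
        ext k
        exact D.rep_smul_zero c x (Sum.inl k) }

end SignedDiagonal

end

/-! ### Dissipative operators: resolvents and exponentials. -/

section DissipativeGeneration

variable {X : Type*} [NormedAddCommGroup X] [InnerProductSpace ℂ X]

open scoped InnerProductSpace

/-! Everything rests on the identity `2 Re ⟨x, 𝒜x⟩ = ‖ℬx‖² - ‖𝒞x‖²` on `D`. In a component with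
entry `δ` of sign `σ`, put `f = δx`. The integrand of `2 Re ⟨x, (δx)'⟩` is `σ (|f|²)'`. Boundedness
of `δ` puts `f` in `L²`, so `|f|²` tends to `0` at infinity and only `-σ|f(0)|²` remains
(`IsWeightedRep.two_mul_re_inner`).

The identity makes `A` dissipative, bounds `𝒞` by the graph norm, is itself the energy balance, and
yields uniqueness and the well-posedness estimate with constant `1`.

For the range condition, `s x - (δx)' = y` is a scalar linear equation for `f`, solved explicitly
with the travel time `φ = ∫ 1/|δ|`. The integration constant is fixed by `f(0) = 0` if `δ < 0` and
by boundedness of `f` if `δ > 0` (`exists_isWeightedRep_resolvent`). Lumer–Phillips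
(`exists_contraction_semigroup`) then gives the semigroup.

Solutions with input come from a lifting with `𝒜B = B`, built from `e^{-φ}`: `v = x - Bu` solves `v'
= Av + B(u - u')`, which Duhamel's formula handles.

The value `G(s)u` equals `𝒞x` for some `x` with `𝒜x = sx`. In a component with `δ > 0` the identity
reads `2 Re s ‖xₖ‖² = -|fₖ(0)|²`, so `fₖ(0) = 0` when `Re s ≥ 0`. Points with `Re s < 0` are
eigenvalues of `A`, hence outside `ρ(A)`. -/

/-- A dissipative operator satisfies the resolvent estimate `Re s ‖x‖ ≤ ‖s x - A x‖`. -/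
theorem norm_le_of_dissipative {A : X →ₗ.[ℂ] X}
    (hdiss : ∀ x : A.domain, (⟪(x : X), A x⟫_ℂ).re ≤ 0) (s : ℂ) (x : A.domain) :
    s.re * ‖(x : X)‖ ≤ ‖s • (x : X) - A x‖ := by
  have h1 : (⟪(x : X), s • (x : X) - A x⟫_ℂ).re = s.re * ‖(x : X)‖ ^ 2 - (⟪(x : X), A x⟫_ℂ).re := by
    rw [inner_sub_right, inner_smul_right, inner_self_eq_norm_sq_to_K]
    simp [← Complex.ofReal_pow]
  have h2 : (⟪(x : X), s • (x : X) - A x⟫_ℂ).re ≤ ‖(x : X)‖ * ‖s • (x : X) - A x‖ :=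
    re_inner_le_norm (𝕜 := ℂ) _ _
  have h3 := hdiss x
  rcases (norm_nonneg (x : X)).eq_or_lt with h | h
  · rw [← h]; simp
  · nlinarith

/-- The resolvent estimate gives injectivity, so any choice of preimages is automatically linear,
and the same estimate bounds it. -/
theorem exists_isResolventAt_of_dissipative {A : X →ₗ.[ℂ] X}
    (hdiss : ∀ x : A.domain, (⟪(x : X), A x⟫_ℂ).re ≤ 0) {s : ℂ} (hs : 0 < s.re)
    (hsurj : ∀ y : X, ∃ x : A.domain, s • (x : X) - A x = y) :
    ∃ R : X →L[ℂ] X, IsResolventAt A s R ∧ ∀ y, s.re * ‖R y‖ ≤ ‖y‖ := by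
  choose r hr using hsurj
  have inj : ∀ x x' : A.domain, s • (x : X) - A x = s • (x' : X) - A x' → x = x' := by
    intro x x' h
    have := norm_le_of_dissipative hdiss s (x - x')
    have h0 : s • ((x - x' : A.domain) : X) - A (x - x') = 0 := by
      rw [A.map_sub, Submodule.coe_sub, smul_sub, ← sub_eq_zero.2 h]; abel
    rw [h0, norm_zero] at this
    have h4 : ‖((x - x' : A.domain) : X)‖ ≤ 0 := by
      by_contra hc
      push Not at hc
      nlinarith
    have := norm_le_zero_iff.1 h4
    rw [Submodule.coe_sub, sub_eq_zero] at this
    exact Subtype.ext this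
  let L : X →ₗ[ℂ] X :=
    { toFun := fun y => r y
      map_add' := fun y y' => by
        rw [← Submodule.coe_add]
        congr 1
        apply inj
        rw [hr, A.map_add, Submodule.coe_add, smul_add, add_sub_add_comm, hr, hr]
      map_smul' := fun c y => by
        rw [RingHom.id_apply, ← Submodule.coe_smul]
        congr 1
        apply inj
        rw [hr, A.map_smul, Submodule.coe_smul, smul_comm, ← smul_sub, hr] }
  have hL : ∀ y, s.re * ‖L y‖ ≤ ‖y‖ := by
    intro y
    have := norm_le_of_dissipative hdiss s (r y)
    rwa [hr] at this
  refine ⟨L.mkContinuous (1 / s.re) fun y => ?_, ⟨fun y => ⟨(r y).2, ?_⟩, fun x => ?_⟩, hL⟩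
  · rw [one_div, ← div_eq_inv_mul, le_div_iff₀ hs, mul_comm]; exact hL y
  · exact hr y
  · exact congrArg Subtype.val (inj _ x (hr _))

theorem hasDerivWithinAt_norm_sq {x : ℝ → X} {x' : X} {s : Set ℝ} {t : ℝ}
    (h : HasDerivWithinAt x x' s t) :
    HasDerivWithinAt (fun r => ‖x r‖ ^ 2) (2 * (⟪x t, x'⟫_ℂ).re) s t := by
  let := InnerProductSpace.rclikeToReal ℂ X
  exact h.norm_sq

/-- If `y ⟂ D(A)` and `y = x - Ax`, pairing with `x` gives `‖x‖² = Re ⟨x, Ax⟩ ≤ 0`, hence `y = 0`.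
-/
theorem dense_domain_of_dissipative [CompleteSpace X] {A : X →ₗ.[ℂ] X}
    (hdiss : ∀ x : A.domain, (⟪(x : X), A x⟫_ℂ).re ≤ 0)
    (hsurj : ∀ y : X, ∃ x : A.domain, (x : X) - A x = y) : Dense (A.domain : Set X) := by
  rw [Submodule.dense_iff_topologicalClosure_eq_top, Submodule.topologicalClosure_eq_top_iff,
    Submodule.eq_bot_iff]
  intro y hy
  obtain ⟨x, rfl⟩ := hsurj y
  have h1 := (Submodule.mem_orthogonal _ _).1 hy x x.2
  rw [inner_sub_right, inner_self_eq_norm_sq_to_K] at h1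
  have h2 := congrArg Complex.re h1
  have h3 := hdiss x
  simp [← Complex.ofReal_pow] at h2
  have h4 : ‖(x : X)‖ = 0 := by nlinarith [norm_nonneg (x : X)]
  have h5 : x = 0 := by ext; simpa using h4
  simp [h5]

theorem IsResolventAt.resolvent_identity {A : X →ₗ.[ℂ] X} {s t : ℂ} {R S : X →L[ℂ] X}
    (hR : IsResolventAt A s R) (hS : IsResolventAt A t S) (y : X) :
    S y = (s - t) • R (S y) + R y := by
  obtain ⟨h, e⟩ := hS.1 y
  have h1 := hR.2 ⟨S y, h⟩
  have h2 : s • S y - A ⟨S y, h⟩ = (s - t) • S y + y := by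
    have e' : A ⟨S y, h⟩ = t • S y - y := eq_sub_of_add_eq' (sub_eq_iff_eq_add.1 e).symm
    rw [e', sub_smul]; abel
  simp only [h2, map_add, map_smul] at h1
  exact h1.symm

/-- The resolvent identity and its mirror image express `(s - t) R S` and `(s - t) S R` by the same
difference `S - R`. -/
theorem IsResolventAt.commute {A : X →ₗ.[ℂ] X} {s t : ℂ} {R S : X →L[ℂ] X}
    (hR : IsResolventAt A s R) (hS : IsResolventAt A t S) (hst : s ≠ t) : Commute R S := by
  ext y
  have h1 := hR.resolvent_identity hS y
  have h2 := hS.resolvent_identity hR y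
  have h3 : (s - t) • (R (S y) - S (R y)) = 0 := by
    have : (s - t) • R (S y) = S y - R y := eq_sub_of_add_eq h1.symm
    have h4 : (t - s) • S (R y) = R y - S y := eq_sub_of_add_eq h2.symm
    rw [smul_sub, this, ← neg_sub t s, neg_smul, h4]; abel
  have := (smul_eq_zero.1 h3).resolve_left (sub_ne_zero.2 hst)
  simpa using sub_eq_zero.1 this

/-! ### Exponentials of bounded dissipative operators -/

variable [CompleteSpace X]

theorem hasDerivAt_exp_smul_apply (L : X →L[ℂ] X) (x : X) (t : ℝ) :
    HasDerivAt (fun r : ℝ => NormedSpace.exp (r • L) x) (NormedSpace.exp (t • L) (L x)) t := by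
  have h := hasDerivAt_exp_smul_const (𝕂 := ℝ) L t
  exact ((ContinuousLinearMap.apply ℂ X x).restrictScalars ℝ).hasFDerivAt.comp_hasDerivAt t h

theorem hasDerivAt_exp_smul_apply' (L : X →L[ℂ] X) (x : X) (t : ℝ) :
    HasDerivAt (fun r : ℝ => NormedSpace.exp (r • L) x) (L (NormedSpace.exp (t • L) x)) t := by
  have h := hasDerivAt_exp_smul_const' (𝕂 := ℝ) L t
  exact ((ContinuousLinearMap.apply ℂ X x).restrictScalars ℝ).hasFDerivAt.comp_hasDerivAt t h

/-- The squared norm of the orbit has derivative `2 Re ⟨·, L ·⟩ ≤ 0`. -/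
theorem norm_exp_smul_apply_le {L : X →L[ℂ] X} (hL : ∀ x, (⟪x, L x⟫_ℂ).re ≤ 0)
    {t : ℝ} (ht : 0 ≤ t) (x : X) : ‖NormedSpace.exp (t • L) x‖ ≤ ‖x‖ := by
  let := InnerProductSpace.rclikeToReal ℂ X
  have hd : ∀ r : ℝ, HasDerivAt (fun r : ℝ => ‖NormedSpace.exp (r • L) x‖ ^ 2)
      (2 * (⟪NormedSpace.exp (r • L) x, L (NormedSpace.exp (r • L) x)⟫_ℂ).re) r :=
    fun r => (hasDerivAt_exp_smul_apply' L x r).norm_sq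
  have hanti : Antitone fun r : ℝ => ‖NormedSpace.exp (r • L) x‖ ^ 2 :=
    antitone_of_hasDerivAt_nonpos hd fun r => by
      have := hL (NormedSpace.exp (r • L) x)
      simp only [Pi.zero_apply]; linarith
  have := hanti ht
  simp only [zero_smul, NormedSpace.exp_zero, one_apply_eq_self] at this
  exact le_of_sq_le_sq this (norm_nonneg _)

theorem exp_smul_apply_add (L : X →L[ℂ] X) (s t : ℝ) (x : X) :
    NormedSpace.exp ((s + t) • L) x = NormedSpace.exp (s • L) (NormedSpace.exp (t • L) x) := by
  let := NormedAlgebra.restrictScalars ℚ ℝ (X →L[ℂ] X)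
  rw [add_smul, NormedSpace.exp_add_of_commute (((Commute.refl L).smul_left s).smul_right t)]
  rfl

/-- The curve `r ↦ e^{rL} e^{(t-r)M} x` joins the two vectors. By commutation its derivative is a
product of contractions applied to `(L - M)x`. This makes the Yosida exponentials Cauchy. -/
theorem norm_exp_smul_sub_le {L M : X →L[ℂ] X} (hL : ∀ x, (⟪x, L x⟫_ℂ).re ≤ 0)
    (hM : ∀ x, (⟪x, M x⟫_ℂ).re ≤ 0) (hLM : Commute L M) {t : ℝ} (ht : 0 ≤ t) (x : X) :
    ‖NormedSpace.exp (t • L) x - NormedSpace.exp (t • M) x‖ ≤ t * ‖L x - M x‖ := by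
  have hcomm : ∀ r : ℝ, Commute (NormedSpace.exp (r • M)) (L - M) := fun r =>
    (((hLM.sub_left (Commute.refl M)).symm.smul_left r).exp_left :
      Commute (NormedSpace.exp (r • M)) (L - M))
  have hd : ∀ r : ℝ, HasDerivAt
      (fun r : ℝ => NormedSpace.exp (r • L) (NormedSpace.exp ((t - r) • M) x))
      (NormedSpace.exp (r • L) (NormedSpace.exp ((t - r) • M) ((L - M) x))) r := by
    intro r
    have h1 : HasDerivAt (fun r : ℝ => NormedSpace.exp (r • L))
      (NormedSpace.exp (r • L) * L) r := hasDerivAt_exp_smul_const (𝕂 := ℝ) L r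
    have h2 : HasDerivAt (fun r : ℝ => NormedSpace.exp ((t - r) • M))
      (-(M * NormedSpace.exp ((t - r) • M))) r := by
      have := (hasDerivAt_exp_smul_const' (𝕂 := ℝ) M (t - r)).scomp r
        ((hasDerivAt_id r).const_sub t)
      simpa [Function.comp_def] using this
    have h3 := ((ContinuousLinearMap.apply ℂ X x).restrictScalars ℝ).hasFDerivAt.comp_hasDerivAt r
      (h1.mul h2)
    refine h3.congr_deriv ?_
    have := congrArg (fun N : X →L[ℂ] X => N x) (hcomm (t - r)).eq
    simp only [mul_apply_eq_comp] at this
    rw [this]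
    simp [sub_eq_add_neg]
  have := norm_image_sub_le_of_norm_deriv_le_segment' (a := 0) (b := t)
    (C := ‖L x - M x‖) (fun r _ => (hd r).hasDerivWithinAt) (fun r hr => by
      refine (norm_exp_smul_apply_le hL hr.1 _).trans ?_
      exact (norm_exp_smul_apply_le hM (by linarith [hr.2]) _).trans le_rfl) t ⟨ht, le_rfl⟩
  simpa [mul_comm] using this

end DissipativeGeneration

/-! ### Yosida approximation and the Lumer–Phillips theorem. -/

section Yosida

variable {X : Type*} [NormedAddCommGroup X] [InnerProductSpace ℂ X]

open scoped InnerProductSpace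

/-- Contractions of `X` converging strongly to the identity on a dense set do so everywhere. -/
theorem tendsto_of_dense_of_norm_le {ι : Type*} {l : Filter ι} {S : ι → X →L[ℂ] X}
    (hS : ∀ᶠ i in l, ∀ x, ‖S i x‖ ≤ ‖x‖) {D : Set X} (hD : Dense D)
    (h : ∀ x ∈ D, Tendsto (fun i => S i x) l (𝓝 x)) (x : X) :
    Tendsto (fun i => S i x) l (𝓝 x) := by
  rw [Metric.tendsto_nhds]
  intro ε hε
  obtain ⟨y, hy, hxy⟩ := Metric.dense_iff.1 hD x (ε / 3) (by positivity)
  filter_upwards [hS, Metric.tendsto_nhds.1 (h y hxy) (ε / 3) (by positivity)] with i h1 h2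
  have h3 := h1 (x - y)
  rw [Metric.mem_ball, dist_eq_norm, ← norm_neg, neg_sub] at hy
  rw [dist_eq_norm] at h2 ⊢
  rw [map_sub] at h3
  calc ‖S i x - x‖ = ‖(S i x - S i y) + (S i y - y) - (x - y)‖ := by congr 1; abel
    _ ≤ ‖S i x - S i y‖ + ‖S i y - y‖ + ‖x - y‖ := by
      refine (norm_sub_le _ _).trans ?_
      gcongr
      exact norm_add_le _ _
    _ < ε := by linarith

/-- The Yosida approximations of a maximal dissipative operator. -/
theorem exists_yosida_approximation [CompleteSpace X] {A : X →ₗ.[ℂ] X}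
    (hdiss : ∀ x : A.domain, (⟪(x : X), A x⟫_ℂ).re ≤ 0)
    (hsurj : ∀ s : ℝ, 0 < s → ∀ y : X, ∃ x : A.domain, (s : ℂ) • (x : X) - A x = y) :
    ∃ L : ℕ → X →L[ℂ] X, (∀ n x, (⟪x, L n x⟫_ℂ).re ≤ 0) ∧ (∀ n m, Commute (L n) (L m)) ∧
      ∀ x : A.domain, Tendsto (fun n => L n (x : X)) atTop (𝓝 (A x)) := by
  have hpos : ∀ n : ℕ, (0 : ℝ) < (n : ℝ) + 1 := fun n => by positivity
  have hR : ∀ n : ℕ, ∃ R : X →L[ℂ] X, IsResolventAt A (((n : ℝ) + 1 : ℝ) : ℂ) R ∧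
      ∀ y, ((n : ℝ) + 1) * ‖R y‖ ≤ ‖y‖ := fun n =>
    exists_isResolventAt_of_dissipative (s := (((n : ℝ) + 1 : ℝ) : ℂ)) hdiss
      (by rw [Complex.ofReal_re]; exact hpos n) (hsurj _ (hpos n))
  choose R hR hRn using hR
  have hd : Dense (A.domain : Set X) := dense_domain_of_dissipative hdiss fun y => by
    simpa using hsurj 1 one_pos y
  let c : ℕ → ℂ := fun n => (((n : ℝ) + 1 : ℝ) : ℂ)
  have hcn : ∀ n, ‖c n‖ = (n : ℝ) + 1 := fun n => by
    simp only [c, Complex.norm_real, Real.norm_eq_abs, abs_of_pos (hpos n)]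
  have hJ : ∀ n y, ‖(c n • R n) y‖ ≤ ‖y‖ := fun n y => by
    rw [smul_apply, norm_smul, hcn]; exact hRn n y
  have hJid : ∀ x ∈ (A.domain : Set X), Tendsto (fun n => (c n • R n) x) atTop (𝓝 x) := by
    intro x hx
    rw [tendsto_iff_norm_sub_tendsto_zero]
    have hb : ∀ n, ‖(c n • R n) x - x‖ ≤ ‖A ⟨x, hx⟩‖ * (1 / ((n : ℝ) + 1)) := by
      intro n
      have h1 := (hR n).2 ⟨x, hx⟩
      have h2 : (c n • R n) x - x = R n (A ⟨x, hx⟩) := by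
        rw [map_sub, map_smul] at h1
        rw [smul_apply]
        exact sub_eq_of_eq_add' (sub_eq_iff_eq_add.1 h1)
      rw [h2, mul_one_div, le_div_iff₀ (hpos n), mul_comm]
      exact hRn n _
    refine squeeze_zero (fun _ => norm_nonneg _) hb ?_
    simpa using tendsto_one_div_add_atTop_nhds_zero_nat.const_mul ‖A ⟨x, hx⟩‖
  -- With `J = cR`, the operator `c(J - 1)` equals `cAR`. It is dissipative because `J` is a
  -- contraction, and on `D(A)` it equals `JA`, which tends to `A` because `J → 1` strongly.
  refine ⟨fun n => c n • (c n • R n - 1), fun n x => ?_, fun n m => ?_, fun x => ?_⟩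
  · have h1 : (⟪x, (c n • R n) x⟫_ℂ).re ≤ ‖x‖ ^ 2 := by
      refine (re_inner_le_norm (𝕜 := ℂ) _ _).trans ?_
      rw [pow_two]
      gcongr
      exact hJ n x
    rw [smul_apply, inner_smul_right, sub_apply,
      inner_sub_right, one_apply_eq_self, inner_self_eq_norm_sq_to_K]
    simp only [c, Complex.re_ofReal_mul]
    refine mul_nonpos_of_nonneg_of_nonpos (hpos n).le ?_
    rw [Complex.sub_re]
    have : (((‖x‖ : ℝ) : ℂ) ^ 2).re = ‖x‖ ^ 2 := by rw [← Complex.ofReal_pow, Complex.ofReal_re]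
    simp only [Complex.coe_algebraMap, this, c] at h1 ⊢
    linarith
  · rcases eq_or_ne n m with rfl | hnm
    · exact Commute.refl _
    · have hc : c n ≠ c m := by
        simp only [c, ne_eq, Complex.ofReal_inj, add_left_inj, Nat.cast_inj]; exact hnm
      have h := (hR n).commute (hR m) hc
      exact ((((h.smul_left _).smul_right _).sub_right (Commute.one_right _)).sub_left
        (Commute.one_left _)).smul_left _ |>.smul_right _
  · refine (tendsto_of_dense_of_norm_le (Eventually.of_forall hJ) hd hJid (A x)).congr fun n => ?_
    have h1 := (hR n).2 x
    rw [map_sub, map_smul] at h1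
    simp only [smul_apply, sub_apply, one_apply_eq_self]
    congr 1
    exact (sub_eq_of_eq_add' (sub_eq_iff_eq_add.1 h1)).symm

/-- The contraction semigroup obtained as the limit of the exponentials of commuting bounded
dissipative operators that converge on a dense subspace. -/
theorem exists_semigroup_of_approximation [CompleteSpace X] {A : X →ₗ.[ℂ] X}
    (hA : Dense (A.domain : Set X)) {L : ℕ → X →L[ℂ] X}
    (hL : ∀ n x, (⟪x, L n x⟫_ℂ).re ≤ 0) (hcomm : ∀ n m, Commute (L n) (L m))
    (hlim : ∀ x : A.domain, Tendsto (fun n => L n (x : X)) atTop (𝓝 (A x))) :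
    ∃ T : ℝ → X →L[ℂ] X, IsC0Semigroup T ∧ (∀ t x, ‖T t x‖ ≤ ‖x‖) ∧
      (∀ t, T t = T (max t 0)) ∧
      ∀ x : A.domain,
        Tendsto (fun t : ℝ => (t : ℂ)⁻¹ • (T t x - x)) (𝓝[>] 0) (𝓝 (A x)) := by
  let E : ℕ → ℝ → X →L[ℂ] X := fun n t => NormedSpace.exp (t • L n)
  have hE : ∀ n t, 0 ≤ t → ∀ x, ‖E n t x‖ ≤ ‖x‖ := fun n t ht x =>
    norm_exp_smul_apply_le (hL n) ht x
  -- The exponentials are contractions, so `x` may be replaced by a nearby `y ∈ D(A)`, for which `L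
  -- n y` converges.
  have hcauchy : ∀ t, 0 ≤ t → ∀ x, CauchySeq fun n => E n t x := by
    intro t ht x
    rw [Metric.cauchySeq_iff]
    intro ε hε
    obtain ⟨y, hy, hyD⟩ := Metric.dense_iff.1 hA x (ε / 4) (by positivity)
    rw [Metric.mem_ball, dist_eq_norm, ← norm_neg, neg_sub] at hy
    obtain ⟨N, hN⟩ := Metric.cauchySeq_iff.1 (hlim ⟨y, hyD⟩).cauchySeq (ε / (4 * (t + 1)))
      (by positivity)
    refine ⟨N, fun m hm n hn => ?_⟩
    have h1 := norm_exp_smul_sub_le (hL m) (hL n) (hcomm m n) ht y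
    have h2 := hN m hm n hn
    rw [dist_eq_norm] at h2 ⊢
    have h3 := hE m t ht (x - y)
    have h4 := hE n t ht (x - y)
    rw [map_sub] at h3 h4
    have h5 : t * ‖L m y - L n y‖ ≤ ε / 4 := by
      calc t * ‖L m y - L n y‖ ≤ (t + 1) * (ε / (4 * (t + 1))) := by gcongr; linarith
        _ = ε / 4 := by field_simp
    calc ‖E m t x - E n t x‖
        = ‖(E m t x - E m t y) + (E m t y - E n t y) - (E n t x - E n t y)‖ := by congr 1; abel
      _ ≤ ‖E m t x - E m t y‖ + ‖E m t y - E n t y‖ + ‖E n t x - E n t y‖ := by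
        refine (norm_sub_le _ _).trans ?_
        gcongr
        exact norm_add_le _ _
      _ < ε := by
        have : ‖E m t y - E n t y‖ ≤ ε / 4 := h1.trans h5
        linarith
  -- Clamping time at `0` gives `T t = T 0` for `t < 0`, so that orbits become continuous on the
  -- whole line.
  have hT : ∀ t : ℝ, ∃ T : X →L[ℂ] X, ∀ x, Tendsto (fun n => E n (max t 0) x) atTop (𝓝 (T x)) := by
    intro t
    choose f hf using fun x => cauchySeq_tendsto_of_complete (hcauchy (max t 0) (le_max_right _ _) x)
    exact ⟨continuousLinearMapOfTendsto (fun n => E n (max t 0)) (tendsto_pi_nhds.2 hf), hf⟩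
  choose T hT using hT
  have hT' : ∀ t, 0 ≤ t → ∀ x, Tendsto (fun n => E n t x) atTop (𝓝 (T t x)) := fun t ht x => by
    have := hT t x
    rwa [max_eq_left ht] at this
  have hTn : ∀ t x, ‖T t x‖ ≤ ‖x‖ := fun t x =>
    le_of_tendsto (hT t x).norm (Eventually.of_forall fun n => hE n _ (le_max_right _ _) x)
  -- the first order expansion at `0` of the approximate orbits
  have hEd : ∀ n t, 0 ≤ t → ∀ (x w : X) (C : ℝ), (∀ r ∈ Ico 0 t, ‖E n r (L n x) - w‖ ≤ C) →
      ‖E n t x - x - t • w‖ ≤ C * t := by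
    intro n t ht x w C hC
    have := norm_image_sub_le_of_norm_deriv_le_segment' (a := 0) (b := t)
      (f := fun r : ℝ => E n r x - r • w) (f' := fun r => E n r (L n x) - w) (C := C)
      (fun r _ => ((hasDerivAt_exp_smul_apply (L n) x r).sub
        (by simpa using (hasDerivAt_id r).smul_const w)).hasDerivWithinAt) hC t ⟨ht, le_rfl⟩
    have h0 : E n 0 x = x := by simp [E]
    simp only [h0, zero_smul, sub_zero] at this
    rwa [sub_right_comm] at this
  have hTD : ∀ (x : A.domain) t, 0 ≤ t → ‖T t x - x‖ ≤ ‖A x‖ * t := by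
    intro x t ht
    refine le_of_tendsto_of_tendsto ((hT' t ht x).sub_const _).norm
      ((hlim x).norm.mul_const t) (Eventually.of_forall fun n => ?_)
    have := hEd n t ht x 0 ‖L n x‖ (fun r hr => by simpa using hE n r hr.1 _)
    simpa using this
  have hcont : ∀ x : X, Tendsto (fun t : ℝ => T t x) (𝓝[>] 0) (𝓝 x) := by
    refine tendsto_of_dense_of_norm_le (Eventually.of_forall hTn) hA fun x hx => ?_
    rw [tendsto_iff_norm_sub_tendsto_zero]
    have h0 : Tendsto (fun t : ℝ => ‖A ⟨x, hx⟩‖ * t) (𝓝[>] 0) (𝓝 0) := by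
      have : Tendsto (fun t : ℝ => ‖A ⟨x, hx⟩‖ * t) (𝓝 0) (𝓝 (‖A ⟨x, hx⟩‖ * 0)) :=
        tendsto_id.const_mul _
      rw [mul_zero] at this
      exact this.mono_left nhdsWithin_le_nhds
    refine squeeze_zero' (Eventually.of_forall fun _ => norm_nonneg _) ?_ h0
    filter_upwards [self_mem_nhdsWithin] with t ht
    exact hTD ⟨x, hx⟩ t (le_of_lt ht)
  refine ⟨T, ⟨?_, ?_, hcont⟩, hTn, ?_, ?_⟩
  · ext x
    refine tendsto_nhds_unique (hT' 0 le_rfl x) ?_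
    simp [E]
  · intro s t hs ht
    ext x
    refine tendsto_nhds_unique (hT' (s + t) (add_nonneg hs ht) x) ?_
    have h1 : Tendsto (fun n => E n s (E n t x) - E n s (T t x)) atTop (𝓝 0) := by
      refine squeeze_zero_norm (fun n => ?_)
        (tendsto_iff_norm_sub_tendsto_zero.1 (hT' t ht x))
      rw [← map_sub]
      exact hE n s hs _
    have h2 := h1.add (hT' s hs (T t x))
    simp only [sub_add_cancel, zero_add] at h2
    refine h2.congr fun n => ?_
    exact (exp_smul_apply_add (L n) s t x).symm
  · intro t
    ext x
    refine tendsto_nhds_unique (hT t x) ?_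
    have := hT (max t 0) x
    rwa [max_eq_left (le_max_right t 0)] at this
  · intro x
    rw [Metric.tendsto_nhds]
    intro ε hε
    obtain ⟨y, hy, hyD⟩ := Metric.dense_iff.1 hA (A x) (ε / 4) (by positivity)
    rw [Metric.mem_ball, dist_eq_norm] at hy
    have hsmall : ∀ᶠ t : ℝ in 𝓝[>] 0, ‖A ⟨y, hyD⟩‖ * t < ε / 4 := by
      have : Tendsto (fun t : ℝ => ‖A ⟨y, hyD⟩‖ * t) (𝓝 0) (𝓝 (‖A ⟨y, hyD⟩‖ * 0)) :=
        tendsto_id.const_mul _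
      rw [mul_zero] at this
      exact (this.mono_left nhdsWithin_le_nhds).eventually_lt_const (by positivity)
    filter_upwards [hsmall, self_mem_nhdsWithin] with t h1 ht
    have ht : 0 < t := ht
    -- The drift of `E n r (A x)` away from `A x` cannot be estimated through the generator, as `A
    -- x` need not lie in `D(A)`. Passing to `y ∈ D(A)` and back costs `2 * ‖y - A x‖`, and the
    -- drift of `y` is at most `‖A y‖ * t` in the limit.
    have key : ‖T t x - x - t • A x‖ ≤ (2 * ‖y - A x‖ + ‖A ⟨y, hyD⟩‖ * t) * t := by
      have hR : Tendsto (fun n => (‖L n x - A x‖ + 2 * ‖y - A x‖ + ‖L n y‖ * t) * t) atTop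
          (𝓝 ((0 + 2 * ‖y - A x‖ + ‖A ⟨y, hyD⟩‖ * t) * t)) :=
        (((tendsto_iff_norm_sub_tendsto_zero.1 (hlim x)).add_const _).add
          ((hlim ⟨y, hyD⟩).norm.mul_const t)).mul_const t
      rw [zero_add] at hR
      refine le_of_tendsto_of_tendsto (((hT' t ht.le x).sub_const _).sub_const _).norm hR
        (Eventually.of_forall fun n => ?_)
      refine hEd n t ht.le x (A x) _ fun r hr => ?_
      have e1 := hE n r hr.1 (L n x - A x)
      have e2 := hE n r hr.1 (A x - y)
      have e3 := hEd n r hr.1 y 0 ‖L n y‖ (fun q hq => by simpa using hE n q hq.1 _)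
      rw [smul_zero, sub_zero] at e3
      rw [map_sub] at e1 e2
      have e4 : ‖L n y‖ * r ≤ ‖L n y‖ * t := by gcongr; exact hr.2.le
      rw [norm_sub_rev] at e2
      rw [← norm_neg, neg_sub, ← norm_neg (A x - y), neg_sub] at e2
      calc ‖E n r (L n x) - A x‖
          = ‖(E n r (L n x) - E n r (A x)) + (E n r (A x) - E n r y) + (E n r y - y)
              + (y - A x)‖ := by congr 1; abel
        _ ≤ ‖E n r (L n x) - E n r (A x)‖ + ‖E n r (A x) - E n r y‖ + ‖E n r y - y‖
              + ‖y - A x‖ := norm_add₄_le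
        _ ≤ _ := by linarith
    have h2 : (t : ℂ)⁻¹ • (T t x - x) - A x = (t : ℂ)⁻¹ • (T t x - x - t • A x) := by
      rw [smul_sub _ (T t x - x : X), ← Complex.coe_smul t (A x), smul_smul,
        inv_mul_cancel₀ (by exact_mod_cast ht.ne'), one_smul]
    rw [dist_eq_norm, h2, norm_smul, norm_inv, Complex.norm_real, Real.norm_eq_abs, abs_of_pos ht,
      inv_mul_lt_iff₀ ht]
    refine key.trans_lt ?_
    rw [mul_comm t]
    gcongr
    linarith

/-- The Lumer–Phillips theorem on a Hilbert space. -/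
theorem exists_contraction_semigroup [CompleteSpace X] {A : X →ₗ.[ℂ] X}
    (hdiss : ∀ x : A.domain, (⟪(x : X), A x⟫_ℂ).re ≤ 0)
    (hsurj : ∀ s : ℝ, 0 < s → ∀ y : X, ∃ x : A.domain, (s : ℂ) • (x : X) - A x = y) :
    ∃ T : ℝ → X →L[ℂ] X, IsC0Semigroup T ∧ IsGeneratorOf A T ∧ (∀ t x, ‖T t x‖ ≤ ‖x‖) ∧
      ∀ t, T t = T (max t 0) := by
  have hsurj1 : ∀ y : X, ∃ x : A.domain, (x : X) - A x = y := fun y => by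
    simpa using hsurj 1 one_pos y
  obtain ⟨L, h1, h2, h3⟩ := exists_yosida_approximation hdiss hsurj
  obtain ⟨T, hT, hTn, hTm, hTA⟩ := exists_semigroup_of_approximation
    (dense_domain_of_dissipative hdiss hsurj1) h1 h2 h3
  refine ⟨T, hT, fun x y => ⟨fun h => ?_, fun h => ?_⟩, hTn, hTm⟩
  · obtain ⟨x', rfl, rfl⟩ := (LinearPMap.mem_graph_iff A).1 h
    exact hTA x'
  -- The generator of `T` is no larger than `A`: otherwise `w = x - x'` would be an eigenvector of
  -- that generator with eigenvalue `1`. Contractivity gives `‖T t w - (1 + t) w‖ ≥ t ‖w‖`, which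
  -- forces `w = 0`.
  · obtain ⟨x', hx'⟩ := hsurj1 (x - y)
    have hw : Tendsto (fun t : ℝ => (t : ℂ)⁻¹ • (T t (x - x') - (x - x'))) (𝓝[>] 0)
        (𝓝 (x - x')) := by
      have h4 := h.sub (hTA x')
      have h5 : y - A x' = x - x' := by
        have : A x' = x' - (x - y) := by rw [← hx']; abel
        rw [this]; abel
      rw [h5] at h4
      refine h4.congr fun t => ?_
      rw [← smul_sub, map_sub]
      congr 1
      abel
    have hz : ‖x - x'‖ ≤ 0 := by
      have h6 : Tendsto (fun t : ℝ => ‖(t : ℂ)⁻¹ • (T t (x - x') - (x - x')) - (x - x')‖)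
          (𝓝[>] 0) (𝓝 0) := tendsto_iff_norm_sub_tendsto_zero.1 hw
      refine ge_of_tendsto h6 ?_
      filter_upwards [self_mem_nhdsWithin] with t ht
      have ht : 0 < t := ht
      set w := x - (x' : X)
      have h7 : (t : ℂ)⁻¹ • (T t w - w) - w = (t : ℂ)⁻¹ • (T t w - (1 + t : ℝ) • w) := by
        have : w = (t : ℂ)⁻¹ • (t • w) := by
          rw [← Complex.coe_smul t w, smul_smul, inv_mul_cancel₀ (by exact_mod_cast ht.ne'),
            one_smul]
        nth_rewrite 3 [this]
        rw [← smul_sub, add_smul, one_smul, sub_sub]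
      rw [h7, norm_smul, norm_inv, Complex.norm_real, Real.norm_eq_abs, abs_of_pos ht,
        le_inv_mul_iff₀ ht]
      have h8 := norm_sub_norm_le ((1 + t : ℝ) • w) (T t w)
      rw [norm_smul, Real.norm_eq_abs, abs_of_pos (by linarith), norm_sub_rev _ (T t w)] at h8
      linarith [hTn t w]
    have hxx : x = x' := sub_eq_zero.1 (norm_le_zero_iff.1 hz)
    rw [LinearPMap.mem_graph_iff]
    refine ⟨x', hxx.symm, ?_⟩
    rw [hxx] at hx'
    exact sub_right_injective hx'

end Yosida

/-! ### Orbits of contraction semigroups and the inhomogeneous Cauchy problem. -/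

section Duhamel

variable {X : Type*} [NormedAddCommGroup X] [NormedSpace ℂ X]

/-- The semigroup law and contractivity bound every increment of the orbit by an increment starting
at time `0`, so right continuity at `0` suffices. -/
theorem IsC0Semigroup.continuous_apply {T : ℝ → X →L[ℂ] X} (hT : IsC0Semigroup T)
    (hTn : ∀ t x, ‖T t x‖ ≤ ‖x‖) (hTm : ∀ t, T t = T (max t 0)) (x : X) :
    Continuous fun t => T t x := by
  have hadd : ∀ s r : ℝ, 0 ≤ s → 0 ≤ r → ‖T (s + r) x - T s x‖ ≤ ‖T r x - x‖ := by
    intro s r hs hr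
    rw [hT.map_add s r hs hr, ContinuousLinearMap.comp_apply, ← map_sub]
    exact hTn _ _
  have hle : ∀ s t : ℝ, ‖T t x - T s x‖ ≤ ‖T |max t 0 - max s 0| x - x‖ := by
    intro s t
    rw [hTm t, hTm s]
    have hs := le_max_right s 0
    have ht := le_max_right t 0
    rcases le_total (max s 0) (max t 0) with h | h
    · have := hadd (max s 0) (max t 0 - max s 0) hs (sub_nonneg.2 h)
      rwa [add_sub_cancel, ← abs_of_nonneg (sub_nonneg.2 h)] at this
    · have := hadd (max t 0) (max s 0 - max t 0) ht (sub_nonneg.2 h)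
      rw [add_sub_cancel, ← abs_of_nonneg (sub_nonneg.2 h), abs_sub_comm] at this
      rwa [norm_sub_rev]
  have h0 : Tendsto (fun r => T r x) (𝓝 0) (𝓝 x) := by
    have h1 : Tendsto (fun r => T r x) (𝓝[≤] 0) (𝓝 x) := by
      refine tendsto_const_nhds.congr' ?_
      filter_upwards [self_mem_nhdsWithin] with r hr
      have hr : r ≤ 0 := hr
      rw [hTm, max_eq_right hr, hT.map_zero, ContinuousLinearMap.id_apply]
    rw [← nhdsLE_sup_nhdsGT]
    exact h1.sup (hT.strongly_continuous x)
  rw [continuous_iff_continuousAt]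
  intro s
  rw [ContinuousAt, tendsto_iff_norm_sub_tendsto_zero]
  have h2 : Tendsto (fun t : ℝ => |max t 0 - max s 0|) (𝓝 s) (𝓝 0) := by
    have : Continuous fun t : ℝ => |max t 0 - max s 0| := by fun_prop
    simpa using this.tendsto s
  exact squeeze_zero (fun _ => norm_nonneg _) (hle s)
    (tendsto_iff_norm_sub_tendsto_zero.1 (h0.comp h2))

theorem IsC0Semigroup.continuous_uncurry {T : ℝ → X →L[ℂ] X} (hT : IsC0Semigroup T)
    (hTn : ∀ t x, ‖T t x‖ ≤ ‖x‖) (hTm : ∀ t, T t = T (max t 0)) :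
    Continuous fun q : ℝ × X => T q.1 q.2 := by
  rw [continuous_iff_continuousAt]
  rintro ⟨s, y⟩
  have h1 : Tendsto (fun q : ℝ × X => T q.1 q.2 - T q.1 y) (𝓝 (s, y)) (𝓝 0) := by
    have h3 : Tendsto (fun q : ℝ × X => ‖q.2 - y‖) (𝓝 (s, y)) (𝓝 0) := by
      have : Continuous fun q : ℝ × X => ‖q.2 - y‖ := by fun_prop
      simpa using this.tendsto (s, y)
    refine squeeze_zero_norm (fun q => ?_) h3
    rw [← map_sub]
    exact hTn _ _
  have h2 : Tendsto (fun q : ℝ × X => T q.1 y) (𝓝 (s, y)) (𝓝 (T s y)) :=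
    ((hT.continuous_apply hTn hTm y).comp continuous_fst).tendsto (s, y)
  simpa [ContinuousAt] using h1.add h2

/-- The orbit of an element of the domain of the generator stays in the domain. -/
theorem IsGeneratorOf.map_mem_graph {A : X →ₗ.[ℂ] X} {T : ℝ → X →L[ℂ] X} (hA : IsGeneratorOf A T)
    (hT : IsC0Semigroup T) {x y : X} (h : (x, y) ∈ A.graph) {t : ℝ} (ht : 0 ≤ t) :
    (T t x, T t y) ∈ A.graph := by
  rw [hA]
  refine (((T t).continuous.tendsto y).comp ((hA x y).1 h)).congr' ?_
  filter_upwards [self_mem_nhdsWithin] with r hr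
  have hr : 0 ≤ r := le_of_lt hr
  have e : T r (T t x) = T t (T r x) := by
    rw [← ContinuousLinearMap.comp_apply, ← hT.map_add r t hr ht, add_comm, hT.map_add t r ht hr,
      ContinuousLinearMap.comp_apply]
  simp only [Function.comp_apply, map_smul, map_sub, e]

variable [CompleteSpace X]

/-- Orbits starting in the domain of the generator are differentiable. -/
theorem IsGeneratorOf.hasDerivWithinAt {A : X →ₗ.[ℂ] X} {T : ℝ → X →L[ℂ] X}
    (hA : IsGeneratorOf A T) (hT : IsC0Semigroup T) (hTn : ∀ t x, ‖T t x‖ ≤ ‖x‖)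
    (hTm : ∀ t, T t = T (max t 0)) {x y : X} (h : (x, y) ∈ A.graph) {t : ℝ} (ht : 0 ≤ t) :
    HasDerivWithinAt (fun r => T r x) (T t y) (Ici 0) t := by
  have hcy := hT.continuous_apply hTn hTm y
  have hint : ∀ r, HasDerivAt (fun r => ∫ s in (0 : ℝ)..r, T s y) (T r y) r := fun r =>
    (hcy.integral_hasStrictDerivAt 0 r).hasDerivAt
  have hright : ∀ r, 0 ≤ r → HasDerivWithinAt (fun r => T r x) (T r y) (Ici r) r := by
    intro r hr
    rw [← hasDerivWithinAt_Ioi_iff_Ici, hasDerivWithinAt_iff_tendsto_slope' self_notMem_Ioi]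
    have h1 : Tendsto (fun q : ℝ => q - r) (𝓝[>] r) (𝓝[>] 0) := by
      refine tendsto_nhdsWithin_iff.2 ⟨?_, ?_⟩
      · have : Tendsto (fun q : ℝ => q - r) (𝓝 r) (𝓝 (r - r)) := tendsto_id.sub_const r
        rw [sub_self] at this
        exact this.mono_left nhdsWithin_le_nhds
      · filter_upwards [self_mem_nhdsWithin] with q hq
        exact sub_pos.2 (mem_Ioi.1 hq)
    refine ((((T r).continuous.tendsto y).comp ((hA x y).1 h)).comp h1).congr' ?_
    filter_upwards [self_mem_nhdsWithin] with q hq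
    have hq : r < q := hq
    have e : T q x = T r (T (q - r) x) := by
      rw [← ContinuousLinearMap.comp_apply, ← hT.map_add r (q - r) hr (sub_nonneg.2 hq.le),
        add_sub_cancel]
    rw [slope_def_module, e, ← map_sub, ← Complex.coe_smul, Complex.ofReal_inv]
    simp only [Function.comp_apply, map_smul]
  -- Only right derivatives are available directly. A continuous function with zero right derivative
  -- is constant, so the orbit is the integral of a continuous function and is differentiable from
  -- both sides.
  have heq : ∀ r, 0 ≤ r → T r x = x + ∫ s in (0 : ℝ)..r, T s y := by
    intro r hr
    have := constant_of_has_deriv_right_zero (a := 0) (b := r)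
      (f := fun r => T r x - ∫ s in (0 : ℝ)..r, T s y)
      ((hT.continuous_apply hTn hTm x).sub
        (continuous_iff_continuousAt.2 fun r => (hint r).continuousAt)).continuousOn
      (fun q hq => by
        have := (hright q hq.1).sub (hint q).hasDerivWithinAt
        rwa [sub_self] at this) r ⟨hr, le_rfl⟩
    simp only [hT.map_zero, ContinuousLinearMap.id_apply, intervalIntegral.integral_same,
      sub_zero] at this
    exact sub_eq_iff_eq_add.1 this
  exact (((hint t).const_add x).hasDerivWithinAt (s := Ici 0)).congr (fun r hr => heq r hr)
    (heq t ht)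

/-- Derivative at `0` of an integral over a shrinking interval. -/
theorem hasDerivAt_integral_add_zero {k : ℝ → ℝ → X} (hk : Continuous (Function.uncurry k))
    (a : ℝ) : HasDerivAt (fun h => ∫ s in a..a + h, k h s) (k 0 a) 0 := by
  rw [hasDerivAt_iff_isLittleO_nhds_zero, Asymptotics.isLittleO_iff]
  intro ε hε
  have h1 := Metric.continuousAt_iff.1 (hk.continuousAt (x := (0, a))) ε hε
  obtain ⟨δ, hδ, h1⟩ := h1
  filter_upwards [Metric.ball_mem_nhds (0 : ℝ) hδ] with h hh
  rw [Metric.mem_ball, dist_zero_right, Real.norm_eq_abs] at hh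
  have hint : IntervalIntegrable (k h) volume a (a + h) :=
    (hk.comp (continuous_const.prodMk continuous_id)).intervalIntegrable _ _
  have h2 : (∫ s in a..a + (0 + h), k (0 + h) s) - (∫ s in a..a + 0, k 0 s) - h • k 0 a
      = ∫ s in a..a + h, (k h s - k 0 a) := by
    rw [intervalIntegral.integral_sub hint (by simp)]
    simp
  rw [h2]
  refine (intervalIntegral.norm_integral_le_of_norm_le_const (C := ε) fun s hs => ?_).trans
    (by simp)
  have h3 : dist (h, s) ((0 : ℝ), a) < δ := by
    rw [Prod.dist_eq, max_lt_iff, dist_zero_right, Real.norm_eq_abs, Real.dist_eq]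
    refine ⟨hh, lt_of_le_of_lt ?_ hh⟩
    have := abs_sub_left_of_mem_uIcc (uIoc_subset_uIcc hs)
    simpa using this
  have := h1 h3
  rw [dist_eq_norm] at this
  exact this.le

/-- The derivative of the Duhamel integral for a `C¹` inhomogeneity. -/
theorem hasDerivAt_duhamel {T : ℝ → X →L[ℂ] X}
    (hTc : Continuous fun q : ℝ × X => T q.1 q.2) (hTn : ∀ t x, ‖T t x‖ ≤ ‖x‖)
    {F F' : ℝ → X} (hF : ∀ t, HasDerivAt F (F' t) t) (hF' : Continuous F') (t : ℝ) :
    HasDerivAt (fun t => ∫ s in (0 : ℝ)..t, T s (F (t - s)))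
      (T t (F 0) + ∫ s in (0 : ℝ)..t, T s (F' (t - s))) t := by
  have hFc : Continuous F := continuous_iff_continuousAt.2 fun t => (hF t).continuousAt
  have hk : Continuous (Function.uncurry fun h s => T s (F (t + h - s))) :=
    hTc.comp (continuous_snd.prodMk (by fun_prop))
  have hk' : ∀ h, Continuous fun s => T s (F' (t + h - s)) := fun h =>
    hTc.comp (continuous_id.prodMk (by fun_prop))
  have hks : ∀ h, Continuous fun s => T s (F (t + h - s)) := fun h =>
    hTc.comp (continuous_id.prodMk (by fun_prop))
  obtain ⟨C, hC⟩ := (isCompact_Icc (a := -(|t| + 1)) (b := |t| + 1)).exists_bound_of_continuousOn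
    hF'.continuousOn
  -- In this form of the convolution the parameter enters through `F` only, so differentiating under
  -- the integral uses `F ∈ C¹` and no differentiability of `T`. The moving endpoint is treated
  -- separately.
  have h1 : HasDerivAt (fun h => ∫ s in (0 : ℝ)..t, T s (F (t + h - s)))
      (∫ s in (0 : ℝ)..t, T s (F' (t + 0 - s))) 0 := by
    refine (intervalIntegral.hasDerivAt_integral_of_dominated_loc_of_deriv_le (𝕜 := ℝ)
      (F' := fun h s => T s (F' (t + h - s))) (bound := fun _ => C)
      (Metric.ball_mem_nhds (0 : ℝ) one_pos)
      (Eventually.of_forall fun h => (hks h).aestronglyMeasurable)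
      ((hks 0).intervalIntegrable _ _) (hk' 0).aestronglyMeasurable
      (Eventually.of_forall fun s hs h hh => ?_) (by simp)
      (Eventually.of_forall fun s _ h _ => ?_)).2
    · refine (hTn _ _).trans (hC _ ?_)
      rw [Metric.mem_ball, dist_zero_right, Real.norm_eq_abs] at hh
      have h2 := abs_sub_right_of_mem_uIcc (uIoc_subset_uIcc hs)
      rw [sub_zero] at h2
      refine mem_Icc.2 (abs_le.1 ?_)
      calc |t + h - s| = |(t - s) + h| := by congr 1; ring
        _ ≤ |t - s| + |h| := abs_add_le _ _
        _ ≤ |t| + 1 := by linarith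
    · have h3 : HasDerivAt (fun h => F (t + h - s)) (F' (t + h - s)) h := by
        have := (hF (t + h - s)).scomp h (((hasDerivAt_id h).const_add t).sub_const s)
        simpa [Function.comp_def] using this
      exact ((T s).restrictScalars ℝ).hasFDerivAt.comp_hasDerivAt h h3
  have h2 := h1.add (hasDerivAt_integral_add_zero hk t)
  have h3 : HasDerivAt (fun h => ∫ s in (0 : ℝ)..t + h, T s (F (t + h - s)))
      (T t (F 0) + ∫ s in (0 : ℝ)..t, T s (F' (t - s))) (t - t) := by
    rw [sub_self]
    refine (h2.congr_deriv (by simp [add_comm])).congr_of_eventuallyEq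
      (Eventually.of_forall fun h => ?_)
    exact (intervalIntegral.integral_add_adjacent_intervals ((hks h).intervalIntegrable _ _)
      ((hks h).intervalIntegrable _ _)).symm
  have h4 := h3.comp_sub_const t t
  simpa using h4

/-- The Duhamel integral of a `C¹` inhomogeneity takes values in the domain of the generator. -/
theorem IsGeneratorOf.duhamel_mem_graph {A : X →ₗ.[ℂ] X} {T : ℝ → X →L[ℂ] X}
    (hA : IsGeneratorOf A T) (hT : IsC0Semigroup T)
    (hTc : Continuous fun q : ℝ × X => T q.1 q.2) {F : ℝ → X} (hF : Continuous F) {t : ℝ}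
    (ht : 0 ≤ t) {w' : X} (hw : HasDerivAt (fun t => ∫ s in (0 : ℝ)..t, T s (F (t - s))) w' t) :
    (∫ s in (0 : ℝ)..t, T s (F (t - s)), w' - F t) ∈ A.graph := by
  rw [hA]
  have hk : Continuous (Function.uncurry fun h s => T s (F (t + h - s))) :=
    hTc.comp (continuous_snd.prodMk (by fun_prop))
  have hks : ∀ h, Continuous fun s => T s (F (t + h - s)) := fun h =>
    hTc.comp (continuous_id.prodMk (by fun_prop))
  have h1 := hw.tendsto_slope_zero_right
  have h2 := (hasDerivAt_integral_add_zero hk 0).tendsto_slope_zero_right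
  have h3 := h1.sub h2
  simp only [add_zero, sub_zero, hT.map_zero, ContinuousLinearMap.id_apply, zero_add,
    intervalIntegral.integral_same] at h3
  refine h3.congr' ?_
  filter_upwards [self_mem_nhdsWithin] with h hh
  have hh : 0 ≤ h := le_of_lt hh
  -- Applying `T h` shifts the convolution to `∫ s in h..t + h`, which is its value at `t + h` minus
  -- `∫ s in 0..h`. After division by `h` the first part yields `w'`, the second `F t`.
  have h4 : T h (∫ s in (0 : ℝ)..t, T s (F (t - s))) = ∫ s in h..t + h, T s (F (t + h - s)) := by
    rw [← ContinuousLinearMap.intervalIntegral_comp_comm]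
    · have := intervalIntegral.integral_comp_add_right (a := 0) (b := t)
        (fun s => T s (F (t + h - s))) h
      rw [zero_add] at this
      rw [← this]
      refine intervalIntegral.integral_congr fun s hs => ?_
      rw [uIcc_of_le ht] at hs
      simp only [add_sub_add_right_eq_sub]
      rw [add_comm s h, hT.map_add h s hh hs.1, ContinuousLinearMap.comp_apply]
    · have := hks 0
      simp only [add_zero] at this
      exact this.intervalIntegrable _ _
  have h5 := intervalIntegral.integral_add_adjacent_intervals (a := 0) (b := h) (c := t + h)
    (μ := volume) ((hks h).intervalIntegrable _ _) ((hks h).intervalIntegrable _ _)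
  rw [h4, ← Complex.coe_smul h⁻¹, ← Complex.coe_smul h⁻¹, ← smul_sub, Complex.ofReal_inv]
  congr 1
  rw [← h5]
  abel

/-- Classical solutions of `v' = A v + F` for a `C¹` inhomogeneity `F`. -/
theorem IsGeneratorOf.exists_solution {A : X →ₗ.[ℂ] X} {T : ℝ → X →L[ℂ] X}
    (hA : IsGeneratorOf A T) (hT : IsC0Semigroup T) (hTn : ∀ t x, ‖T t x‖ ≤ ‖x‖)
    (hTm : ∀ t, T t = T (max t 0)) {F F' : ℝ → X} (hF : ∀ t, HasDerivAt F (F' t) t)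
    (hF' : Continuous F') (v₀ : A.domain) :
    ∃ v v' : ℝ → X, v 0 = v₀ ∧ Continuous v' ∧ ∀ t, 0 ≤ t →
      HasDerivWithinAt v (v' t) (Ici 0) t ∧ (v t, v' t - F t) ∈ A.graph := by
  have hTc := hT.continuous_uncurry hTn hTm
  have hFc : Continuous F := continuous_iff_continuousAt.2 fun t => (hF t).continuousAt
  have h0 : ((v₀ : X), A v₀) ∈ A.graph := A.mem_graph v₀
  refine ⟨fun t => T t v₀ + ∫ s in (0 : ℝ)..t, T s (F (t - s)),
    fun t => T t (A v₀) + (T t (F 0) + ∫ s in (0 : ℝ)..t, T s (F' (t - s))), ?_, ?_,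
    fun t ht => ⟨?_, ?_⟩⟩
  · simp [hT.map_zero]
  · refine (hT.continuous_apply hTn hTm _).add ((hT.continuous_apply hTn hTm _).add ?_)
    exact intervalIntegral.continuous_parametric_intervalIntegral_of_continuous
      (f := fun t s => T s (F' (t - s)))
      (hTc.comp (continuous_snd.prodMk (by fun_prop))) continuous_id
  · exact (hA.hasDerivWithinAt hT hTn hTm h0 ht).add
      (hasDerivAt_duhamel hTc hTn hF hF' t).hasDerivWithinAt
  · have h1 := hA.map_mem_graph hT h0 ht
    have h2 := hA.duhamel_mem_graph hT hTc hFc ht (hasDerivAt_duhamel hTc hTn hF hF' t)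
    have h3 := A.graph.add_mem h1 h2
    rwa [Prod.mk_add_mk, ← add_sub_assoc] at h3

end Duhamel

/-! ### Absolute continuity, weighted `L²`, and the energy identity in one component. -/

section HalfLine

open scoped InnerProductSpace ComplexConjugate

/-! ### Absolutely continuous functions on intervals -/

/-- Used to pass between complex functions and their real and imaginary parts. -/
theorem AbsolutelyContinuousOnInterval.of_dist_le {E F : Type*} [PseudoMetricSpace E]
    [PseudoMetricSpace F] {f : ℝ → E} {g : ℝ → F} {a b : ℝ}
    (hf : AbsolutelyContinuousOnInterval f a b) (h : ∀ x y, dist (g x) (g y) ≤ dist (f x) (f y)) :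
    AbsolutelyContinuousOnInterval g a b :=
  squeeze_zero (fun _ => Finset.sum_nonneg fun _ _ => dist_nonneg)
    (fun _ => Finset.sum_le_sum fun _ _ => h _ _) hf

theorem AbsolutelyContinuousOnInterval.norm_sq {f : ℝ → ℂ} {a b : ℝ}
    (hf : AbsolutelyContinuousOnInterval f a b) :
    AbsolutelyContinuousOnInterval (fun x => ‖f x‖ ^ 2) a b := by
  have hre : AbsolutelyContinuousOnInterval (fun x => (f x).re) a b := hf.of_dist_le fun x y => by
    rw [Real.dist_eq, ← Complex.sub_re, dist_eq_norm]; exact Complex.abs_re_le_norm _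
  have him : AbsolutelyContinuousOnInterval (fun x => (f x).im) a b := hf.of_dist_le fun x y => by
    rw [Real.dist_eq, ← Complex.sub_im, dist_eq_norm]; exact Complex.abs_im_le_norm _
  have := (hre.mul hre).add (him.mul him)
  refine this.of_dist_le fun x y => le_of_eq ?_
  simp only [← Complex.normSq_eq_norm_sq, Complex.normSq_apply, Pi.add_apply, Pi.mul_apply]

theorem absolutelyContinuousOnInterval_integral_complex {f : ℝ → ℂ}
    (hf : ∀ a b : ℝ, IntervalIntegrable f volume a b) (a b : ℝ) :
    AbsolutelyContinuousOnInterval (fun x => ∫ v in (0 : ℝ)..x, f v) a b := by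
  have hre : ∀ c d : ℝ, IntervalIntegrable (fun x => (f x).re) volume c d := fun c d =>
    ⟨(hf c d).1.re, (hf c d).2.re⟩
  have him : ∀ c d : ℝ, IntervalIntegrable (fun x => (f x).im) volume c d := fun c d =>
    ⟨(hf c d).1.im, (hf c d).2.im⟩
  have key : ∀ {g : ℝ → ℝ}, (∀ c d : ℝ, IntervalIntegrable g volume c d) →
      AbsolutelyContinuousOnInterval (fun x => ∫ v in (0 : ℝ)..x, g v) a b := fun {g} hg => by
    have h0 : uIcc a b ⊆ uIcc (min (min a b) 0) (max (max a b) 0) := by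
      intro x hx
      rcases mem_uIcc.1 hx with h | h <;>
      · exact mem_uIcc.2 (Or.inl ⟨min_le_of_left_le (by simp [h]), le_max_of_le_left (by simp [h])⟩)
    exact ((hg _ _).absolutelyContinuousOnInterval_intervalIntegral
      (mem_uIcc.2 (Or.inl ⟨min_le_right _ _, le_max_right _ _⟩))).mono h0
  have h1 : AbsolutelyContinuousOnInterval
      (fun x => ((∫ v in (0 : ℝ)..x, (f v).re : ℝ) : ℂ)) a b :=
    (key hre).of_dist_le fun x y => le_of_eq (Complex.isometry_ofReal.dist_eq _ _)
  have h2 : AbsolutelyContinuousOnInterval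
      (fun x => ((∫ v in (0 : ℝ)..x, (f v).im : ℝ) : ℂ)) a b :=
    (key him).of_dist_le fun x y => le_of_eq (Complex.isometry_ofReal.dist_eq _ _)
  refine (h1.add (h2.const_smul Complex.I)).of_dist_le fun x y => le_of_eq ?_
  have h3 : ∀ x, ∫ v in (0 : ℝ)..x, f v = ((∫ v in (0 : ℝ)..x, (f v).re : ℝ) : ℂ)
      + Complex.I • ((∫ v in (0 : ℝ)..x, (f v).im : ℝ) : ℂ) := by
    intro x
    have e1 := Complex.reCLM.intervalIntegral_comp_comm (hf 0 x)
    have e2 := Complex.imCLM.intervalIntegral_comp_comm (hf 0 x)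
    simp only [Complex.reCLM_apply, Complex.imCLM_apply] at e1 e2
    rw [e1, e2, smul_eq_mul, mul_comm, Complex.re_add_im]
  simp only [h3, Pi.add_apply]

theorem hasDerivAt_norm_sq {f : ℝ → ℂ} {z : ℂ} {x : ℝ} (h : HasDerivAt f z x) :
    HasDerivAt (fun x => ‖f x‖ ^ 2) (2 * (conj (f x) * z).re) x := by
  have := h.norm_sq
  rwa [Complex.inner, mul_comm z] at this

/-- The fundamental theorem of calculus for `‖f‖²`. -/
theorem LocallyAbsolutelyContinuous.integral_norm_sq {f z : ℝ → ℂ}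
    (hf : LocallyAbsolutelyContinuous f)
    (hz : ∀ᵐ ξ ∂(volume.restrict (Ici (0 : ℝ))), HasDerivAt f (z ξ) ξ) {N : ℝ} (hN : 0 ≤ N) :
    IntervalIntegrable (fun ξ => 2 * (conj (f ξ) * z ξ).re) volume 0 N ∧
    ∫ ξ in (0 : ℝ)..N, 2 * (conj (f ξ) * z ξ).re = ‖f N‖ ^ 2 - ‖f 0‖ ^ 2 := by
  have hac := (hf 0 N le_rfl hN).norm_sq
  have hae : ∀ᵐ ξ, ξ ∈ uIoc 0 N →
      deriv (fun ξ => ‖f ξ‖ ^ 2) ξ = 2 * (conj (f ξ) * z ξ).re := by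
    rw [ae_restrict_iff' measurableSet_Ici] at hz
    filter_upwards [hz] with ξ h hξ
    rw [uIoc_of_le hN] at hξ
    exact (hasDerivAt_norm_sq (h hξ.1.le)).deriv
  rw [← hac.integral_deriv_eq_sub]
  refine ⟨hac.intervalIntegrable_deriv.congr_ae ?_, intervalIntegral.integral_congr_ae ?_⟩
  · rwa [← ae_restrict_iff' measurableSet_uIoc] at hae
  · filter_upwards [hae] with ξ h hξ
    exact (h hξ).symm

/-! ### Weighted spaces -/

variable {δ : ℝ → ℝ}

theorem aemeasurable_weight (hδ : ContinuousOn δ (Ici 0)) :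
    AEMeasurable (fun ξ => ENNReal.ofReal |δ ξ|) (volume.restrict (Ici 0)) :=
  (hδ.abs.aemeasurable measurableSet_Ici).ennreal_ofReal

theorem integrable_weightedMeasure_iff {E : Type*} [NormedAddCommGroup E] [NormedSpace ℝ E]
    (hδ : ContinuousOn δ (Ici 0)) {g : ℝ → E} :
    Integrable g (weightedMeasure δ) ↔ IntegrableOn (fun ξ => |δ ξ| • g ξ) (Ici 0) := by
  rw [weightedMeasure, integrable_withDensity_iff_integrable_smul₀' (aemeasurable_weight hδ)
    (Eventually.of_forall fun _ => ENNReal.ofReal_lt_top)]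
  simp only [ENNReal.toReal_ofReal (abs_nonneg _), IntegrableOn]

theorem integral_weightedMeasure {E : Type*} [NormedAddCommGroup E] [NormedSpace ℝ E]
    (hδ : ContinuousOn δ (Ici 0)) (g : ℝ → E) :
    ∫ ξ, g ξ ∂(weightedMeasure δ) = ∫ ξ in Ici 0, |δ ξ| • g ξ := by
  rw [weightedMeasure, integral_withDensity_eq_integral_toReal_smul₀ (aemeasurable_weight hδ)
    (Eventually.of_forall fun _ => ENNReal.ofReal_lt_top)]
  simp only [ENNReal.toReal_ofReal (abs_nonneg _)]

theorem memLp_weightedMeasure (hδ : ContinuousOn δ (Ici 0)) {g : ℝ → ℂ}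
    (hg : AEStronglyMeasurable g (volume.restrict (Ici 0)))
    (hint : IntegrableOn (fun ξ => |δ ξ| * ‖g ξ‖ ^ 2) (Ici 0)) : MemLp g 2 (weightedMeasure δ) := by
  rw [memLp_two_iff_integrable_sq_norm (μ := weightedMeasure δ) (hg.mono_ac (withDensity_absolutelyContinuous _ _)),
    integrable_weightedMeasure_iff hδ]
  exact hint

theorem integrableOn_weight_mul_sq (hδ : ContinuousOn δ (Ici 0))
    (x : Lp ℂ 2 (weightedMeasure δ)) : IntegrableOn (fun ξ => |δ ξ| * ‖x ξ‖ ^ 2) (Ici 0) := by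
  have := (memLp_two_iff_integrable_sq_norm (Lp.memLp x).1).1 (Lp.memLp x)
  rwa [integrable_weightedMeasure_iff hδ] at this

/-- `f` is the locally absolutely continuous representative of `δ x`, with derivative `z`. -/
structure IsWeightedRep (δ : ℝ → ℝ) (x : Lp ℂ 2 (weightedMeasure δ)) (f : ℝ → ℂ)
    (z : Lp ℂ 2 (weightedMeasure δ)) : Prop where
  absCont : LocallyAbsolutelyContinuous f
  eq_mul : ∀ᵐ ξ ∂(volume.restrict (Ici (0 : ℝ))), f ξ = (δ ξ : ℂ) * x ξ
  hasDerivAt : ∀ᵐ ξ ∂(volume.restrict (Ici (0 : ℝ))), HasDerivAt f (z ξ) ξ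

/-- The energy identity `2 Re ⟨x, (δ x)'⟩ = -σ |(δ x)(0)|²`, where `σ` is the sign of `δ`. -/
theorem IsWeightedRep.two_mul_re_inner {x z : Lp ℂ 2 (weightedMeasure δ)} {f : ℝ → ℂ}
    (h : IsWeightedRep δ x f z) (hδ : ContinuousOn δ (Ici 0)) {σ M : ℝ}
    (hσ2 : σ * σ = 1) (hσ : ∀ ξ, 0 ≤ ξ → |δ ξ| = σ * δ ξ) (hM : ∀ ξ, 0 ≤ ξ → |δ ξ| ≤ M) :
    2 * (⟪x, z⟫_ℂ).re = -(σ * ‖f 0‖ ^ 2) := by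
  have hin : IntegrableOn (fun ξ => |δ ξ| • ⟪x ξ, z ξ⟫_ℂ) (Ici 0) :=
    (integrable_weightedMeasure_iff hδ).1 (L2.integrable_inner x z)
  -- Since `δ` is real and `|δ| = σδ`, the weight `|δ|` turns `conj x` into `σ conj f`.
  have hpt : ∀ᵐ ξ ∂(volume.restrict (Ici (0 : ℝ))),
      σ * (2 * (conj (f ξ) * z ξ).re) = 2 * (|δ ξ| • ⟪x ξ, z ξ⟫_ℂ).re := by
    filter_upwards [h.eq_mul, ae_restrict_mem measurableSet_Ici] with ξ h1 hξ
    have hξ : 0 ≤ ξ := hξ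
    rw [h1, RCLike.inner_apply', hσ ξ hξ, Complex.smul_re, map_mul, Complex.conj_ofReal,
      smul_eq_mul, mul_assoc (δ ξ : ℂ), Complex.re_ofReal_mul]
    ring
  have hg : IntegrableOn (fun ξ => 2 * (conj (f ξ) * z ξ).re) (Ici 0) := by
    have h2 : IntegrableOn (fun ξ => σ * (2 * (|δ ξ| • ⟪x ξ, z ξ⟫_ℂ).re)) (Ici 0) :=
      (hin.re.const_mul 2).const_mul σ
    refine h2.congr ?_
    filter_upwards [hpt] with ξ h1
    rw [← h1, ← mul_assoc, hσ2, one_mul]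
  -- Here the bound on `δ` enters: `|f|² = |δ| · |δ||x|² ≤ M |δ||x|²`.
  have hfint : IntegrableOn (fun ξ => ‖f ξ‖ ^ 2) (Ici 0) := by
    refine ((integrableOn_weight_mul_sq hδ x).const_mul M).mono'
      ((h.absCont.continuousOn.norm.pow 2).aestronglyMeasurable measurableSet_Ici) ?_
    filter_upwards [h.eq_mul, ae_restrict_mem measurableSet_Ici] with ξ h1 hξ
    rw [h1, norm_mul, Complex.norm_real, Real.norm_eq_abs, Real.norm_eq_abs,
      abs_of_nonneg (by positivity), mul_pow,
      pow_two |δ ξ|, mul_assoc]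
    gcongr
    exact hM ξ hξ
  -- The limit exists because the derivative of `|f|²` is integrable. It must vanish because `|f|²`
  -- is integrable on a half-line of infinite length.
  have hlim : Tendsto (fun N => ‖f N‖ ^ 2) atTop
      (𝓝 ((∫ ξ in Ioi (0 : ℝ), 2 * (conj (f ξ) * z ξ).re) + ‖f 0‖ ^ 2)) := by
    refine ((intervalIntegral_tendsto_integral_Ioi 0 (hg.mono_set Ioi_subset_Ici_self)
      tendsto_id).add_const (‖f 0‖ ^ 2)).congr' ?_
    filter_upwards [eventually_ge_atTop 0] with N hN
    rw [id, (h.absCont.integral_norm_sq h.hasDerivAt hN).2, sub_add_cancel]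
  have hzero := IntegrableAtFilter.eq_zero_of_tendsto (μ := volume)
    ⟨Ici 0, Ici_mem_atTop 0, hfint⟩ (fun s hs => by
      obtain ⟨a, ha⟩ := mem_atTop_sets.1 hs
      exact measure_mono_top (s₁ := Ici a) (fun b hb => ha b hb) Real.volume_Ici) hlim
  have hfin : 2 * (⟪x, z⟫_ℂ).re = σ * ∫ ξ in Ioi (0 : ℝ), 2 * (conj (f ξ) * z ξ).re := by
    rw [L2.inner_def, integral_weightedMeasure hδ, ← integral_Ici_eq_integral_Ioi,
      ← integral_const_mul, integral_congr_ae hpt, integral_const_mul]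
    congr 1
    exact (integral_re hin).symm
  rw [hfin, eq_neg_of_add_eq_zero_left hzero]
  ring

end HalfLine

/-! ### Travel time, eigenfunctions and the resolvent equation in one component. -/

noncomputable section
section TravelTime

open scoped InnerProductSpace ComplexConjugate

/-- The reciprocal `1 / |δ|` of the speed, extended continuously to `ℝ`. -/
def slowness (δ : ℝ → ℝ) (η : ℝ) : ℝ := |δ (max η 0)|⁻¹

/-- The travel time `∫₀^ξ 1 / |δ|` from `0` to `ξ`. -/
def travelTime (δ : ℝ → ℝ) (ξ : ℝ) : ℝ := ∫ η in (0 : ℝ)..ξ, slowness δ η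

variable {δ : ℝ → ℝ}

theorem slowness_eq {ξ : ℝ} (hξ : 0 ≤ ξ) : slowness δ ξ = |δ ξ|⁻¹ := by
  rw [slowness, max_eq_left hξ]

theorem slowness_nonneg (ξ : ℝ) : 0 ≤ slowness δ ξ := inv_nonneg.2 (abs_nonneg _)

theorem continuous_slowness (hδ : ContinuousOn δ (Ici 0)) (h0 : ∀ ξ, 0 ≤ ξ → δ ξ ≠ 0) :
    Continuous (slowness δ) := by
  refine Continuous.inv₀ ?_ fun η => abs_ne_zero.2 (h0 _ (le_max_right _ _))
  exact (hδ.comp_continuous (continuous_id.max continuous_const) fun η => mem_Ici.2 (le_max_right _ _)).abs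

theorem hasDerivAt_travelTime (hδ : ContinuousOn δ (Ici 0)) (h0 : ∀ ξ, 0 ≤ ξ → δ ξ ≠ 0) (ξ : ℝ) :
    HasDerivAt (travelTime δ) (slowness δ ξ) ξ :=
  ((continuous_slowness hδ h0).integral_hasStrictDerivAt 0 ξ).hasDerivAt

theorem continuous_travelTime (hδ : ContinuousOn δ (Ici 0)) (h0 : ∀ ξ, 0 ≤ ξ → δ ξ ≠ 0) :
    Continuous (travelTime δ) :=
  continuous_iff_continuousAt.2 fun ξ => (hasDerivAt_travelTime hδ h0 ξ).continuousAt

theorem travelTime_zero : travelTime δ 0 = 0 := intervalIntegral.integral_same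

theorem hasDerivAt_exp_travelTime (hδ : ContinuousOn δ (Ici 0)) (h0 : ∀ ξ, 0 ≤ ξ → δ ξ ≠ 0)
    (c : ℂ) (ξ : ℝ) : HasDerivAt (fun ξ => Complex.exp (c * travelTime δ ξ))
      (c * slowness δ ξ * Complex.exp (c * travelTime δ ξ)) ξ := by
  have := ((hasDerivAt_travelTime hδ h0 ξ).ofReal_comp.const_mul c).cexp
  rwa [mul_comm (Complex.exp _)] at this

theorem continuous_exp_travelTime (hδ : ContinuousOn δ (Ici 0)) (h0 : ∀ ξ, 0 ≤ ξ → δ ξ ≠ 0)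
    (c : ℂ) : Continuous fun ξ => Complex.exp (c * travelTime δ ξ) :=
  continuous_iff_continuousAt.2 fun ξ => (hasDerivAt_exp_travelTime hδ h0 c ξ).continuousAt

theorem absolutelyContinuousOnInterval_exp_travelTime (hδ : ContinuousOn δ (Ici 0))
    (h0 : ∀ ξ, 0 ≤ ξ → δ ξ ≠ 0) (c : ℂ) (a b : ℝ) :
    AbsolutelyContinuousOnInterval (fun ξ => Complex.exp (c * travelTime δ ξ)) a b := by
  have hd := hasDerivAt_exp_travelTime hδ h0 c
  have : ContDiff ℝ 1 fun ξ => Complex.exp (c * travelTime δ ξ) := by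
    rw [contDiff_one_iff_deriv]
    refine ⟨fun ξ => (hd ξ).differentiableAt, ?_⟩
    rw [funext fun ξ => (hd ξ).deriv]
    exact (continuous_const.mul (Complex.continuous_ofReal.comp (continuous_slowness hδ h0))).mul
      (continuous_exp_travelTime hδ h0 c)
  exact this.contDiffOn.absolutelyContinuousOnInterval

/-- The integrand is an exact derivative because `slowness δ` is the derivative of the travel time.
The bound does not depend on the endpoints. -/
theorem integral_slowness_mul_exp_le (hδ : ContinuousOn δ (Ici 0)) (h0 : ∀ ξ, 0 ≤ ξ → δ ξ ≠ 0)
    {κ : ℝ} (hκ : 0 < κ) (a b : ℝ) :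
    ∫ η in a..b, slowness δ η * Real.exp (-κ * (travelTime δ η - travelTime δ a)) ≤ κ⁻¹ := by
  have hd : ∀ η, HasDerivAt
      (fun η => -κ⁻¹ * Real.exp (-κ * (travelTime δ η - travelTime δ a)))
      (slowness δ η * Real.exp (-κ * (travelTime δ η - travelTime δ a))) η := by
    intro η
    refine ((((hasDerivAt_travelTime hδ h0 η).sub_const _).const_mul (-κ)).exp.const_mul
      (-κ⁻¹)).congr_deriv ?_
    field_simp
  have hc : Continuous fun η =>
      slowness δ η * Real.exp (-κ * (travelTime δ η - travelTime δ a)) := by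
    have h1 := continuous_slowness hδ h0
    have h2 := continuous_travelTime hδ h0
    fun_prop
  rw [intervalIntegral.integral_eq_sub_of_hasDerivAt (fun η _ => hd η) (hc.intervalIntegrable _ _)]
  have := Real.exp_pos (-κ * (travelTime δ b - travelTime δ a))
  have h2 : 0 < κ⁻¹ := inv_pos.2 hκ
  simp only [sub_self, mul_zero, Real.exp_zero]
  nlinarith

theorem integrableOn_slowness_mul_exp (hδ : ContinuousOn δ (Ici 0)) (h0 : ∀ ξ, 0 ≤ ξ → δ ξ ≠ 0)
    {κ : ℝ} (hκ : 0 < κ) :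
    IntegrableOn (fun η => slowness δ η * Real.exp (-κ * travelTime δ η)) (Ioi 0) := by
  have hc : Continuous fun η => slowness δ η * Real.exp (-κ * travelTime δ η) := by
    have h1 := continuous_slowness hδ h0
    have h2 := continuous_travelTime hδ h0
    fun_prop
  refine integrableOn_Ioi_of_intervalIntegral_norm_bounded κ⁻¹ 0
    (fun b : ℝ => hc.integrableOn_Ioc) tendsto_id (Eventually.of_forall fun b => ?_)
  have := integral_slowness_mul_exp_le hδ h0 hκ 0 b
  simp only [travelTime_zero, sub_zero] at this
  refine le_trans (le_of_eq (intervalIntegral.integral_congr fun η _ => ?_)) this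
  exact Real.norm_of_nonneg (mul_nonneg (slowness_nonneg _) (Real.exp_pos _).le)

theorem ofReal_slowness {σ : ℝ} (hσ2 : σ * σ = 1) (hσ : ∀ ξ, 0 ≤ ξ → |δ ξ| = σ * δ ξ) {ξ : ℝ}
    (hξ : 0 ≤ ξ) : slowness δ ξ = σ * (δ ξ)⁻¹ := by
  rw [slowness_eq hξ, hσ ξ hξ, mul_inv, inv_eq_of_mul_eq_one_left hσ2]

/-- For `x = f / δ` the weighted density `|δ||x|²` is `|f|² / |δ|`. -/
theorem exists_lp_eq_mul (hδ : ContinuousOn δ (Ici 0)) (h0 : ∀ ξ, 0 ≤ ξ → δ ξ ≠ 0) {f : ℝ → ℂ}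
    (hf : ContinuousOn f (Ici 0))
    (hint : IntegrableOn (fun ξ => slowness δ ξ * ‖f ξ‖ ^ 2) (Ioi 0)) :
    ∃ x : Lp ℂ 2 (weightedMeasure δ),
      ∀ᵐ ξ ∂(volume.restrict (Ici (0 : ℝ))), f ξ = (δ ξ : ℂ) * x ξ := by
  have hmem : MemLp (fun ξ => (δ ξ : ℂ)⁻¹ * f ξ) 2 (weightedMeasure δ) := by
    refine memLp_weightedMeasure hδ ?_ ?_
    · refine ContinuousOn.aestronglyMeasurable (ContinuousOn.mul (ContinuousOn.inv₀
        (Complex.continuous_ofReal.comp_continuousOn hδ) fun ξ hξ => ?_) hf) measurableSet_Ici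
      exact_mod_cast h0 ξ hξ
    · rw [← integrableOn_Ici_iff_integrableOn_Ioi] at hint
      refine hint.congr_fun (fun ξ hξ => ?_) measurableSet_Ici
      have : |δ ξ| ≠ 0 := abs_ne_zero.2 (h0 ξ hξ)
      simp only [slowness_eq (mem_Ici.1 hξ), norm_mul, norm_inv, Complex.norm_real,
        Real.norm_eq_abs]
      field_simp
  refine ⟨hmem.toLp _, ?_⟩
  have := hmem.coeFn_toLp
  rw [EventuallyEq, ae_weightedMeasure hδ h0] at this
  filter_upwards [this, ae_restrict_mem measurableSet_Ici] with ξ h1 hξ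
  rw [h1, mul_inv_cancel_left₀]
  exact_mod_cast h0 ξ hξ

theorem IsWeightedRep.smul {x z : Lp ℂ 2 (weightedMeasure δ)} {f : ℝ → ℂ}
    (h : IsWeightedRep δ x f z) (hδ : ContinuousOn δ (Ici 0)) (h0 : ∀ ξ, 0 ≤ ξ → δ ξ ≠ 0) (c : ℂ) :
    IsWeightedRep δ (c • x) (c • f) (c • z) := by
  have hx := Lp.coeFn_smul c x
  have hz := Lp.coeFn_smul c z
  rw [EventuallyEq, ae_weightedMeasure hδ h0] at hx hz
  refine ⟨fun a b ha hb => (h.absCont a b ha hb).const_smul c, ?_, ?_⟩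
  · filter_upwards [h.eq_mul, hx] with ξ h1 h2
    simp only [h2, Pi.smul_apply, h1, smul_eq_mul]
    ring
  · filter_upwards [h.hasDerivAt, hz] with ξ h1 h2
    rw [h2]
    exact h1.const_smul c

/-- The decaying eigenfunction of `x ↦ (δ x)'`. -/
theorem exists_isWeightedRep_eigen (hδ : ContinuousOn δ (Ici 0)) (h0 : ∀ ξ, 0 ≤ ξ → δ ξ ≠ 0)
    {σ : ℝ} (hσ2 : σ * σ = 1) (hσ : ∀ ξ, 0 ≤ ξ → |δ ξ| = σ * δ ξ) {c : ℂ} (hc : 0 < c.re) :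
    ∃ (x : Lp ℂ 2 (weightedMeasure δ)) (f : ℝ → ℂ),
      IsWeightedRep δ x f ((-(c * σ)) • x) ∧ f 0 = 1 := by
  -- With `1/|δ| = σ/δ`, one has `f' = -c f/|δ| = -cσ f/δ`, so the eigenvalue is `-cσ`.
  let f : ℝ → ℂ := fun ξ => Complex.exp (-c * travelTime δ ξ)
  have hint : IntegrableOn (fun ξ => slowness δ ξ * ‖f ξ‖ ^ 2) (Ioi 0) := by
    refine (integrableOn_slowness_mul_exp hδ h0 (κ := 2 * c.re) (by positivity)).congr_fun
      (fun ξ _ => ?_) measurableSet_Ioi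
    simp only [f, Complex.norm_exp, ← Real.exp_nat_mul]
    congr 2
    simp
    ring
  obtain ⟨x, hx⟩ := exists_lp_eq_mul hδ h0 (continuous_exp_travelTime hδ h0 (-c)).continuousOn hint
  refine ⟨x, f, ⟨fun a b _ _ => absolutelyContinuousOnInterval_exp_travelTime hδ h0 (-c) a b, hx, ?_⟩,
    by simp [f, travelTime_zero]⟩
  have hsm := Lp.coeFn_smul (-(c * σ)) x
  rw [EventuallyEq, ae_weightedMeasure hδ h0] at hsm
  filter_upwards [hx, hsm, ae_restrict_mem measurableSet_Ici] with ξ h1 h2 hξ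
  refine (hasDerivAt_exp_travelTime hδ h0 (-c) ξ).congr_deriv ?_
  have h3 : (δ ξ : ℂ) ≠ 0 := by exact_mod_cast h0 ξ hξ
  rw [h2, Pi.smul_apply, h1, ofReal_slowness hσ2 hσ hξ, smul_eq_mul]
  push_cast
  field_simp

/-! ### The resolvent equation -/

theorem two_mul_mul_le_weighted {d : ℝ} (hd : 0 < d) (a b : ℝ) :
    2 * (a * b) ≤ d⁻¹ * a ^ 2 + d * b ^ 2 := by
  have h : 0 ≤ d⁻¹ * (a - d * b) ^ 2 := by positivity
  have e : d⁻¹ * (a - d * b) ^ 2 = d⁻¹ * a ^ 2 - 2 * (a * b) + d * b ^ 2 := by field_simp; ring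
  linarith

/-- An a priori estimate for solutions of `f' = σ s f / |δ| - y`. -/
theorem integrableOn_slowness_mul_norm_sq (hδ : ContinuousOn δ (Ici 0))
    (h0 : ∀ ξ, 0 ≤ ξ → δ ξ ≠ 0) {σ : ℝ} (hσ2 : σ * σ = 1) {s : ℂ} (hs : 0 < s.re)
    (y : Lp ℂ 2 (weightedMeasure δ)) {f : ℝ → ℂ} (hf : LocallyAbsolutelyContinuous f)
    (hd : ∀ᵐ ξ ∂(volume.restrict (Ici (0 : ℝ))),
      HasDerivAt f (σ * s * slowness δ ξ * f ξ - y ξ) ξ)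
    {K : ℝ} (hK : ∀ N, 0 ≤ N → σ * (‖f N‖ ^ 2 - ‖f 0‖ ^ 2) ≤ K) :
    IntegrableOn (fun ξ => slowness δ ξ * ‖f ξ‖ ^ 2) (Ioi 0) := by
  have hy := integrableOn_weight_mul_sq hδ y
  have hcont : ContinuousOn (fun ξ => slowness δ ξ * ‖f ξ‖ ^ 2) (Ici 0) :=
    (continuous_slowness hδ h0).continuousOn.mul (hf.continuousOn.norm.pow 2)
  have hic : ∀ N, 0 ≤ N → IntervalIntegrable (fun ξ => slowness δ ξ * ‖f ξ‖ ^ 2) volume 0 N :=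
    fun N hN => (hcont.mono (by rw [uIcc_of_le hN]; exact Icc_subset_Ici_self)).intervalIntegrable
  have hiy : ∀ N, 0 ≤ N → IntervalIntegrable (fun ξ => |δ ξ| * ‖y ξ‖ ^ 2) volume 0 N := by
    intro N hN
    rw [intervalIntegrable_iff_integrableOn_Ioc_of_le hN]
    exact hy.mono_set (Ioc_subset_Ioi_self.trans Ioi_subset_Ici_self)
  have hσa : |σ| = 1 := by
    rw [← sq_eq_sq₀ (abs_nonneg _) zero_le_one, sq_abs, pow_two, hσ2, one_pow]
  -- The bound comes from integrating `(σ|f|²)' ≥ Re s |f|²/|δ| - |δ||y|²/Re s` over `[0, N]`, where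
  -- the left side contributes at most `K`.
  refine integrableOn_Ioi_of_intervalIntegral_norm_bounded
    (s.re⁻¹ * (K + s.re⁻¹ * ∫ ξ in Ici 0, |δ ξ| * ‖y ξ‖ ^ 2)) 0
    (fun N : ℝ => ?_) tendsto_id ?_
  · exact ((hcont.mono Icc_subset_Ici_self).integrableOn_Icc (a := 0) (b := N)).mono_set
      Ioc_subset_Icc_self
  filter_upwards [eventually_ge_atTop 0] with N hN
  obtain ⟨h1, h2⟩ := hf.integral_norm_sq hd hN
  have h3 : ∫ ξ in (0 : ℝ)..N, (s.re * (slowness δ ξ * ‖f ξ‖ ^ 2) - s.re⁻¹ * (|δ ξ| * ‖y ξ‖ ^ 2))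
      ≤ ∫ ξ in (0 : ℝ)..N, σ * (2 * (conj (f ξ) * (σ * s * slowness δ ξ * f ξ - y ξ)).re) := by
    refine intervalIntegral.integral_mono_on hN (((hic N hN).const_mul _).sub
      ((hiy N hN).const_mul _)) (h1.const_mul σ) fun ξ hξ => ?_
    have e1 : σ * (2 * (conj (f ξ) * (σ * s * slowness δ ξ * f ξ - y ξ)).re)
        = 2 * s.re * (slowness δ ξ * ‖f ξ‖ ^ 2) - 2 * (σ * (conj (f ξ) * y ξ).re) := by
      have : conj (f ξ) * (σ * s * slowness δ ξ * f ξ - y ξ)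
          = ((σ * (slowness δ ξ * ‖f ξ‖ ^ 2) : ℝ) : ℂ) * s - conj (f ξ) * y ξ := by
        have := Complex.conj_mul' (f ξ)
        push_cast
        rw [← this]
        ring
      rw [this, Complex.sub_re, Complex.re_ofReal_mul]
      linear_combination 2 * (slowness δ ξ * ‖f ξ‖ ^ 2) * s.re * hσ2
    have e2 : σ * (conj (f ξ) * y ξ).re ≤ ‖f ξ‖ * ‖y ξ‖ := by
      refine (le_abs_self _).trans ?_
      rw [abs_mul, hσa, one_mul]
      refine (Complex.abs_re_le_norm _).trans ?_
      rw [norm_mul, Complex.norm_conj]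
    have hdpos : 0 < |δ ξ| := abs_pos.2 (h0 ξ hξ.1)
    -- This `d` absorbs exactly half of the term `2 Re s |f|²/|δ|`.
    have e3 := two_mul_mul_le_weighted (d := |δ ξ| * s.re⁻¹) (by positivity) ‖f ξ‖ ‖y ξ‖
    rw [mul_inv, inv_inv, ← slowness_eq hξ.1] at e3
    rw [e1]
    linarith
  rw [intervalIntegral.integral_sub ((hic N hN).const_mul _) ((hiy N hN).const_mul _),
    intervalIntegral.integral_const_mul, intervalIntegral.integral_const_mul,
    intervalIntegral.integral_const_mul, h2] at h3
  have h4 : ∫ ξ in (0 : ℝ)..N, |δ ξ| * ‖y ξ‖ ^ 2 ≤ ∫ ξ in Ici 0, |δ ξ| * ‖y ξ‖ ^ 2 := by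
    rw [intervalIntegral.integral_of_le hN]
    exact setIntegral_mono_set hy (Eventually.of_forall fun ξ => by positivity)
      (Eventually.of_forall (Ioc_subset_Ioi_self.trans Ioi_subset_Ici_self))
  have h5 : s.re⁻¹ * ∫ ξ in (0 : ℝ)..N, |δ ξ| * ‖y ξ‖ ^ 2
      ≤ s.re⁻¹ * ∫ ξ in Ici 0, |δ ξ| * ‖y ξ‖ ^ 2 := by gcongr
  rw [le_inv_mul_iff₀ hs]
  have h6 : ∫ ξ in (0 : ℝ)..id N, ‖slowness δ ξ * ‖f ξ‖ ^ 2‖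
      = ∫ ξ in (0 : ℝ)..N, slowness δ ξ * ‖f ξ‖ ^ 2 :=
    intervalIntegral.integral_congr fun ξ _ =>
      Real.norm_of_nonneg (mul_nonneg (slowness_nonneg _) (by positivity))
  rw [h6]
  linarith [hK N hN]

/-- The resolvent equation `s x - (δ x)' = y`, with `(δ x)(0) = 0` where `δ < 0`. -/
theorem exists_isWeightedRep_resolvent (hδ : ContinuousOn δ (Ici 0)) (h0 : ∀ ξ, 0 ≤ ξ → δ ξ ≠ 0)
    {σ : ℝ} (hσ2 : σ * σ = 1) (hσ : ∀ ξ, 0 ≤ ξ → |δ ξ| = σ * δ ξ) {s : ℂ} (hs : 0 < s.re)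
    (y : Lp ℂ 2 (weightedMeasure δ)) :
    ∃ (x : Lp ℂ 2 (weightedMeasure δ)) (f : ℝ → ℂ),
      IsWeightedRep δ x f (s • x - y) ∧ (σ = -1 → f 0 = 0) := by
  have hy := integrableOn_weight_mul_sq hδ y
  have hwc := continuous_slowness hδ h0
  have hφc := continuous_travelTime hδ h0
  let Y : ℝ → ℂ := (Ici 0).indicator y
  let W : ℝ → ℝ := (Ici 0).indicator fun ξ => |δ ξ| * ‖y ξ‖ ^ 2
  have hWi : Integrable W := hy.integrable_indicator measurableSet_Ici
  have hW0 : ∀ ξ, 0 ≤ W ξ := fun ξ => indicator_nonneg (fun ξ _ => by positivity) ξ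
  have hYm : AEStronglyMeasurable Y := by
    rw [aestronglyMeasurable_indicator_iff measurableSet_Ici]
    refine (Lp.aestronglyMeasurable y).mono_ac ?_
    exact Measure.ae_le_iff_absolutelyContinuous.1 (ae_weightedMeasure hδ h0).ge
  have hYW : ∀ a ξ : ℝ, 2 * (a * ‖Y ξ‖) ≤ slowness δ ξ * a ^ 2 + W ξ := by
    intro a ξ
    by_cases hξ : ξ ∈ Ici (0 : ℝ)
    · simp only [Y, W, indicator_of_mem hξ]
      rw [slowness_eq hξ]
      exact two_mul_mul_le_weighted (abs_pos.2 (h0 ξ hξ)) _ _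
    · simp only [Y, W, indicator_of_notMem hξ, norm_zero, mul_zero, add_zero]
      exact mul_nonneg (slowness_nonneg _) (sq_nonneg _)
  -- Variation of constants: with `φ` the travel time, `f' = cf/|δ| - y` has the solutions `e^{cφ}(C
  -- - ∫ e^{-cφ} y)`.
  let c : ℂ := σ * s
  let E : ℝ → ℂ := fun ξ => Complex.exp (-c * travelTime δ ξ) * Y ξ
  have hEm : AEStronglyMeasurable E :=
    (continuous_exp_travelTime hδ h0 (-c)).aestronglyMeasurable.mul hYm
  have hEn : ∀ ξ, ‖E ξ‖ = Real.exp (-c.re * travelTime δ ξ) * ‖Y ξ‖ := by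
    intro ξ
    simp only [E, norm_mul, Complex.norm_exp]
    congr 2
    simp
  have hEi : ∀ a b : ℝ, IntervalIntegrable E volume a b := by
    intro a b
    have hg : IntervalIntegrable
        (fun ξ => slowness δ ξ * Real.exp (-c.re * travelTime δ ξ) ^ 2 + W ξ) volume a b :=
      (Continuous.intervalIntegrable (by fun_prop) _ _).add hWi.intervalIntegrable
    refine hg.mono_fun hEm.restrict (Eventually.of_forall fun ξ => ?_)
    refine le_trans (le_of_eq (hEn ξ)) (le_trans ?_ (le_abs_self _))
    have h1 := hYW (Real.exp (-c.re * travelTime δ ξ)) ξ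
    have : 0 ≤ Real.exp (-c.re * travelTime δ ξ) * ‖Y ξ‖ := by positivity
    linarith
  -- a constant of integration for which the solution is bounded from the relevant side
  have hC : ∃ C : ℂ, (σ = -1 → C = 0) ∧ (σ = 1 → ∃ K : ℝ, ∀ ξ, 0 ≤ ξ →
      ‖Complex.exp (c * travelTime δ ξ) * (C - ∫ η in (0 : ℝ)..ξ, E η)‖ ≤ K) := by
    by_cases h1 : σ = 1
    swap
    · exact ⟨0, fun _ => rfl, fun h => absurd h h1⟩
    have hcre : c.re = s.re := by simp [c, h1]
    have hEI : IntegrableOn E (Ioi 0) := by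
      refine ((integrableOn_slowness_mul_exp hδ h0 (κ := 2 * s.re) (by positivity)).add
        hWi.integrableOn).mono' hEm.restrict (Eventually.of_forall fun ξ => ?_)
      have h2 := hYW (Real.exp (-c.re * travelTime δ ξ)) ξ
      rw [hEn]
      have h3 : Real.exp (-c.re * travelTime δ ξ) ^ 2
          = Real.exp (-(2 * s.re) * travelTime δ ξ) := by
        rw [← Real.exp_nat_mul, hcre]; congr 1; push_cast; ring
      rw [h3] at h2
      have : 0 ≤ Real.exp (-c.re * travelTime δ ξ) * ‖Y ξ‖ := by positivity
      simp only [Pi.add_apply]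
      linarith
    -- Taking `C` as the full integral turns the solution into `e^{cφ(ξ)} ∫_ξ^∞ E`, where the
    -- growing factor is compensated by the tail. Young's inequality `hYW` and the endpoint-free
    -- exponential bound give the constant.
    refine ⟨∫ ξ in Ioi 0, E ξ, fun h => by rw [h1] at h; norm_num at h, fun _ =>
      ⟨(2 * s.re)⁻¹ + ∫ ξ, W ξ, fun ξ hξ => ?_⟩⟩
    have hlim : Tendsto (fun R : ℝ => ‖Complex.exp (c * travelTime δ ξ) * ∫ η in ξ..R, E η‖) atTop
        (𝓝 ‖Complex.exp (c * travelTime δ ξ) *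
          ((∫ ξ in Ioi 0, E ξ) - ∫ η in (0 : ℝ)..ξ, E η)‖) := by
      refine Tendsto.norm (Tendsto.const_mul _ ?_)
      refine ((intervalIntegral_tendsto_integral_Ioi 0 hEI tendsto_id).sub_const
        (∫ η in (0 : ℝ)..ξ, E η)).congr fun R => ?_
      exact intervalIntegral.integral_interval_sub_left (hEi _ _) (hEi _ _)
    refine le_of_tendsto hlim ?_
    filter_upwards [eventually_ge_atTop ξ] with R hR
    rw [norm_mul]
    have h4 : ‖Complex.exp (c * travelTime δ ξ)‖ = Real.exp (s.re * travelTime δ ξ) := by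
      rw [Complex.norm_exp, ← hcre]; simp
    have hci : Continuous fun η =>
        slowness δ η * Real.exp (-(2 * s.re) * (travelTime δ η - travelTime δ ξ)) := by fun_prop
    calc ‖Complex.exp (c * travelTime δ ξ)‖ * ‖∫ η in ξ..R, E η‖
        ≤ Real.exp (s.re * travelTime δ ξ) * ∫ η in ξ..R, ‖E η‖ := by
          rw [h4]; gcongr; exact intervalIntegral.norm_integral_le_integral_norm hR
      _ = ∫ η in ξ..R, Real.exp (s.re * travelTime δ ξ) * ‖E η‖ :=
          (intervalIntegral.integral_const_mul _ _).symm
      _ ≤ ∫ η in ξ..R, (slowness δ η * Real.exp (-(2 * s.re) * (travelTime δ η - travelTime δ ξ))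
            + W η) := by
          refine intervalIntegral.integral_mono_on hR ((hEi _ _).norm.const_mul _)
            ((hci.intervalIntegrable _ _).add hWi.intervalIntegrable) fun η _ => ?_
          rw [hEn, ← mul_assoc, ← Real.exp_add, hcre]
          have h5 := hYW (Real.exp (s.re * travelTime δ ξ + -s.re * travelTime δ η)) η
          have h6 : Real.exp (s.re * travelTime δ ξ + -s.re * travelTime δ η) ^ 2
              = Real.exp (-(2 * s.re) * (travelTime δ η - travelTime δ ξ)) := by
            rw [← Real.exp_nat_mul]; congr 1; push_cast; ring
          rw [h6] at h5
          have : 0 ≤ Real.exp (s.re * travelTime δ ξ + -s.re * travelTime δ η) * ‖Y η‖ := by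
            positivity
          linarith
      _ = (∫ η in ξ..R, slowness δ η * Real.exp (-(2 * s.re) * (travelTime δ η - travelTime δ ξ)))
            + ∫ η in ξ..R, W η :=
          intervalIntegral.integral_add (hci.intervalIntegrable _ _) hWi.intervalIntegrable
      _ ≤ (2 * s.re)⁻¹ + ∫ ξ, W ξ := by
          refine add_le_add (integral_slowness_mul_exp_le hδ h0 (by positivity) _ _) ?_
          rw [intervalIntegral.integral_of_le hR]
          exact setIntegral_le_integral hWi (Eventually.of_forall hW0)
  obtain ⟨C, hCneg, hCpos⟩ := hC
  let f : ℝ → ℂ := fun ξ => Complex.exp (c * travelTime δ ξ) * (C - ∫ η in (0 : ℝ)..ξ, E η)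
  have hac : LocallyAbsolutelyContinuous f := fun a b _ _ =>
    (absolutelyContinuousOnInterval_exp_travelTime hδ h0 c a b).smul
      ((absolutelyContinuousOnInterval_integral_complex hEi a b).of_dist_le
        (g := fun ξ => C - ∫ η in (0 : ℝ)..ξ, E η) fun x y => by rw [dist_sub_left])
  have hEl : LocallyIntegrable E := fun ξ =>
    ⟨Ioc (ξ - 1) (ξ + 1), Ioc_mem_nhds (by linarith) (by linarith), (hEi _ _).1⟩
  have hfd : ∀ᵐ ξ ∂(volume.restrict (Ici (0 : ℝ))),
      HasDerivAt f (σ * s * slowness δ ξ * f ξ - y ξ) ξ := by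
    filter_upwards [ae_restrict_of_ae (LocallyIntegrable.ae_hasDerivAt_integral hEl),
      ae_restrict_mem measurableSet_Ici] with ξ h1 hξ
    refine ((hasDerivAt_exp_travelTime hδ h0 c ξ).mul ((h1 0).const_sub C)).congr_deriv ?_
    have h2 : Complex.exp (c * travelTime δ ξ) * E ξ = y ξ := by
      simp only [E, Y, indicator_of_mem hξ]
      rw [← mul_assoc, ← Complex.exp_add]
      simp
    rw [mul_neg, h2]
    simp only [f, c]
    ring
  -- Only one side is needed: for `σ = 1` it follows from boundedness of `f`, while for `σ = -1` the
  -- term `-‖f N‖ ^ 2` has the favourable sign.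
  have hK : ∃ K, ∀ N, 0 ≤ N → σ * (‖f N‖ ^ 2 - ‖f 0‖ ^ 2) ≤ K := by
    rcases mul_self_eq_one_iff.1 hσ2 with h | h
    · obtain ⟨K, hK⟩ := hCpos h
      refine ⟨K ^ 2, fun N hN => ?_⟩
      have h1 : ‖f N‖ ^ 2 ≤ K ^ 2 := by gcongr; exact hK N hN
      rw [h]
      nlinarith [sq_nonneg ‖f 0‖]
    · refine ⟨‖f 0‖ ^ 2, fun N hN => ?_⟩
      rw [h]
      nlinarith [sq_nonneg ‖f N‖]
  obtain ⟨K, hK⟩ := hK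
  obtain ⟨x, hx⟩ := exists_lp_eq_mul hδ h0 hac.continuousOn
    (integrableOn_slowness_mul_norm_sq hδ h0 hσ2 hs y hac hfd hK)
  refine ⟨x, f, ⟨hac, hx, ?_⟩, fun h => by simp [f, hCneg h]⟩
  have h1 := Lp.coeFn_sub (s • x) y
  have h2 := Lp.coeFn_smul s x
  rw [EventuallyEq, ae_weightedMeasure hδ h0] at h1 h2
  filter_upwards [hx, hfd, h1, h2, ae_restrict_mem measurableSet_Ici] with ξ e1 e2 e3 e4 hξ
  refine e2.congr_deriv ?_
  have h3 : (δ ξ : ℂ) ≠ 0 := by exact_mod_cast h0 ξ hξ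
  have h4 : (σ : ℂ) * σ = 1 := by exact_mod_cast hσ2
  rw [e3, Pi.sub_apply, e4, Pi.smul_apply, e1, ofReal_slowness hσ2 hσ hξ, smul_eq_mul]
  push_cast
  field_simp
  linear_combination s * x ξ * h4

end TravelTime
end

/-! ### Abstract consequences of energy preservation for boundary systems. -/

namespace BoundarySystem

open scoped InnerProductSpace

variable {X U Y : Type*}
  [NormedAddCommGroup X] [InnerProductSpace ℂ X] [CompleteSpace X]
  [NormedAddCommGroup U] [InnerProductSpace ℂ U] [CompleteSpace U]
  [NormedAddCommGroup Y] [InnerProductSpace ℂ Y] [CompleteSpace Y]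
  {S : BoundarySystem X U Y}

theorem mem_restrictedOp_domain {x : X} :
    x ∈ S.restrictedOp.domain ↔
      ∃ h : x ∈ S.opA.domain, S.opB ⟨x, S.domain_le h⟩ = 0 := by
  constructor
  · rintro ⟨⟨w, hw, rfl⟩, h⟩
    exact ⟨h, hw⟩
  · rintro ⟨h, h0⟩
    exact ⟨⟨⟨x, S.domain_le h⟩, h0, rfl⟩, h⟩

theorem restrictedOp_apply (x : S.restrictedOp.domain) :
    S.restrictedOp x = S.opA ⟨x, S.restrictedOp_domain_le x.2⟩ :=
  LinearPMap.domRestrict_apply rfl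

/-- The system is scattering energy preserving. -/
def IsEnergyPreserving (S : BoundarySystem X U Y) : Prop :=
  ∀ x : S.opA.domain, 2 * (⟪(x : X), S.opA x⟫_ℂ).re =
    ‖S.opB ⟨x, S.domain_le x.2⟩‖ ^ 2 - ‖S.opC x‖ ^ 2

theorem IsEnergyPreserving.dissipative (hS : S.IsEnergyPreserving) (x : S.restrictedOp.domain) :
    2 * (⟪(x : X), S.restrictedOp x⟫_ℂ).re =
      -‖S.opC ⟨x, S.restrictedOp_domain_le x.2⟩‖ ^ 2 := by
  obtain ⟨h, h0⟩ := mem_restrictedOp_domain.1 x.2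
  have := hS ⟨x, h⟩
  rw [restrictedOp_apply, this, h0, norm_zero]
  ring

/-- On `ker ℬ`, `‖𝒞x‖² = -2 Re ⟨x, Ax⟩ ≤ 2‖x‖‖Ax‖ ≤ (‖x‖ + ‖Ax‖)²`. -/
theorem IsEnergyPreserving.output_bounded (hS : S.IsEnergyPreserving)
    (x : S.restrictedOp.domain) :
    ‖S.opC ⟨x, S.restrictedOp_domain_le x.2⟩‖ ≤ 1 * (‖(x : X)‖ + ‖S.restrictedOp x‖) := by
  rw [one_mul]
  refine abs_le_of_sq_le_sq' ?_ (by positivity) |>.2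
  have h1 := hS.dissipative x
  have h2 : |(⟪(x : X), S.restrictedOp x⟫_ℂ).re| ≤ ‖(x : X)‖ * ‖S.restrictedOp x‖ :=
    (Complex.abs_re_le_norm _).trans (norm_inner_le_norm _ _)
  nlinarith [neg_abs_le (⟪(x : X), S.restrictedOp x⟫_ℂ).re, norm_nonneg (x : X),
    norm_nonneg (S.restrictedOp x)]

theorem IsEnergyPreserving.energyBalance (hS : S.IsEnergyPreserving) : S.EnergyBalance := by
  intro τ x₀ u x y _ hx t ht
  obtain ⟨h, hd, hu, hy⟩ := hx.equations t ht
  have := hasDerivWithinAt_norm_sq hd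
  rwa [hS ⟨x t, h⟩, hu, hy] at this

theorem IsClassicalSolution.sub {τ : ℝ} {x₀ x₀' : X} {u u' : ℝ → U} {x x' : ℝ → X} {y y' : ℝ → Y}
    (h : S.IsClassicalSolution τ x₀ u x y) (h' : S.IsClassicalSolution τ x₀' u' x' y') :
    S.IsClassicalSolution τ (x₀ - x₀') (u - u') (x - x') (y - y') where
  initial := by rw [Pi.sub_apply, h.initial, h'.initial]
  contDiffOn := h.contDiffOn.sub h'.contDiffOn
  equations t ht := by
    obtain ⟨hm, hd, hu, hy⟩ := h.equations t ht
    obtain ⟨hm', hd', hu', hy'⟩ := h'.equations t ht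
    refine ⟨S.opA.domain.sub_mem hm hm', ?_, ?_, ?_⟩
    · have := hd.sub hd'
      rwa [← LinearPMap.map_sub] at this
    · exact (S.opB.map_sub ⟨x t, S.domain_le hm⟩ ⟨x' t, S.domain_le hm'⟩).trans
        (by rw [hu, hu', Pi.sub_apply])
    · exact (S.opC.map_sub ⟨x t, hm⟩ ⟨x' t, hm'⟩).trans (by rw [hy, hy', Pi.sub_apply])

/-- Classical solutions are determined by their initial value and their input. -/
theorem IsClassicalSolution.eqOn (hS : S.EnergyBalance) {τ : ℝ} (hτ : 0 < τ) {x₀ : X} {u : ℝ → U}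
    {x x' : ℝ → X} {y y' : ℝ → Y}
    (h : S.IsClassicalSolution τ x₀ u x y) (h' : S.IsClassicalSolution τ x₀ u x' y') :
    EqOn x x' (Icc 0 τ) := by
  have hd := hS τ _ _ _ _ hτ (h.sub h')
  -- The difference of two solutions has zero input, so its energy cannot grow from its initial
  -- value `0`.
  have hanti : AntitoneOn (fun r => ‖(x - x') r‖ ^ 2) (Icc 0 τ) := by
    refine antitoneOn_of_hasDerivWithinAt_nonpos (convex_Icc _ _)
      (fun t ht => (hd t ht).continuousWithinAt)
      (fun t ht => (hd t (interior_subset ht)).mono interior_subset) fun t _ => ?_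
    simp only [Pi.sub_apply, sub_self, norm_zero]
    nlinarith [sq_nonneg ‖y t - y' t‖]
  intro t ht
  have h1 := hanti ⟨le_rfl, hτ.le⟩ ht ht.1
  simp only [Pi.sub_apply, h.initial, h'.initial, sub_self, norm_zero] at h1
  have h2 : ‖x t - x' t‖ = 0 := by nlinarith [norm_nonneg (x t - x' t)]
  exact sub_eq_zero.1 (norm_eq_zero.1 h2)

/-- The integrated energy balance. -/
theorem IsClassicalSolution.norm_sq_add_integral (hS : S.IsEnergyPreserving) {τ : ℝ} (hτ : 0 < τ)
    {x₀ : X} {u : ℝ → U} {x : ℝ → X} {y : ℝ → Y} (h : S.IsClassicalSolution τ x₀ u x y)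
    (hu : ContinuousOn u (Icc 0 τ)) :
    IntervalIntegrable (fun t => ‖y t‖ ^ 2) volume 0 τ ∧
    ‖x τ‖ ^ 2 + ∫ t in (0 : ℝ)..τ, ‖y t‖ ^ 2 = ‖x₀‖ ^ 2 + ∫ t in (0 : ℝ)..τ, ‖u t‖ ^ 2 := by
  have hd := hS.energyBalance τ _ _ _ _ hτ h
  have hUD : UniqueDiffOn ℝ (Icc 0 τ) := uniqueDiffOn_Icc hτ
  have hx' : ContinuousOn (derivWithin x (Icc 0 τ)) (Icc 0 τ) :=
    h.contDiffOn.continuousOn_derivWithin hUD le_rfl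
  -- Continuity of `‖y‖²` is read off from the energy identity, whose other terms involve only `u`,
  -- `x` and the derivative of `x`.
  have hyc : ContinuousOn (fun t => ‖y t‖ ^ 2) (Icc 0 τ) := by
    have h1 : ContinuousOn
        (fun t => ‖u t‖ ^ 2 - 2 * (⟪x t, derivWithin x (Icc 0 τ) t⟫_ℂ).re) (Icc 0 τ) :=
      (hu.norm.pow 2).sub ((Complex.continuous_re.comp_continuousOn
        (h.contDiffOn.continuousOn.inner hx')).const_mul 2)
    refine h1.congr fun t ht => ?_
    obtain ⟨hm, hd, hu, hy⟩ := h.equations t ht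
    have := hS ⟨x t, hm⟩
    rw [hu, hy] at this
    simp only [hd.derivWithin (hUD t ht), this]
    ring
  have hyi : IntervalIntegrable (fun t => ‖y t‖ ^ 2) volume 0 τ :=
    ContinuousOn.intervalIntegrable (by rwa [uIcc_of_le hτ.le])
  have hui : IntervalIntegrable (fun t => ‖u t‖ ^ 2) volume 0 τ :=
    ContinuousOn.intervalIntegrable (by rw [uIcc_of_le hτ.le]; exact hu.norm.pow 2)
  have h2 := intervalIntegral.integral_eq_sub_of_hasDerivAt_of_le hτ.le
    (fun t ht => (hd t ht).continuousWithinAt)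
    (fun t ht => (hd t (Ioo_subset_Icc_self ht)).hasDerivAt (Icc_mem_nhds ht.1 ht.2))
    (hui.sub hyi)
  rw [intervalIntegral.integral_sub hui hyi, h.initial] at h2
  exact ⟨hyi, by linarith⟩

/-- A `C¹` function on a compact interval extends to a `C¹` function on the line. -/
theorem exists_hasDerivAt_eqOn {E : Type*} [NormedAddCommGroup E] [NormedSpace ℝ E]
    [CompleteSpace E] {τ : ℝ} (hτ : 0 < τ) {g : ℝ → E} (hg : ContDiffOn ℝ 1 g (Icc 0 τ)) :
    ∃ G G' : ℝ → E, (∀ t, HasDerivAt G (G' t) t) ∧ Continuous G' ∧ EqOn G g (Icc 0 τ) := by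
  have hUD : UniqueDiffOn ℝ (Icc 0 τ) := uniqueDiffOn_Icc hτ
  have hg' := hg.continuousOn_derivWithin hUD le_rfl
  -- The derivative is frozen at its endpoint values outside `[0, τ]` and then integrated.
  let G' : ℝ → E := fun t => derivWithin g (Icc 0 τ) (projIcc 0 τ hτ.le t)
  have hG' : Continuous G' := hg'.comp_continuous
    (continuous_subtype_val.comp continuous_projIcc) fun t => (projIcc 0 τ hτ.le t).2
  refine ⟨fun t => g 0 + ∫ s in (0 : ℝ)..t, G' s, G', fun t =>
    ((hG'.integral_hasStrictDerivAt 0 t).hasDerivAt).const_add _, hG', fun t ht => ?_⟩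
  have hsub : Icc 0 t ⊆ Icc 0 τ := Icc_subset_Icc_right ht.2
  have h1 := intervalIntegral.integral_eq_sub_of_hasDerivAt_of_le (f := g) (f' := G') ht.1
    (hg.continuousOn.mono hsub) (fun r hr => ?_) (hG'.intervalIntegrable _ _)
  · simp only [h1, add_sub_cancel]
  · have hr' : r ∈ Icc 0 τ := hsub (Ioo_subset_Icc_self hr)
    have h2 := ((hg.differentiableOn one_ne_zero) r hr').hasDerivWithinAt.hasDerivAt
      (Icc_mem_nhds hr.1 (hr.2.trans_le ht.2))
    simpa only [G', projIcc_of_mem hτ.le hr'] using h2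

/-- Subtracting `Bu` removes the boundary input. As `𝒜B = B`, the remainder `v = x - Bu` solves `v'
= Av + B(u - u')`, and `u ∈ C²` makes this forcing `C¹`. -/
theorem IsEnergyPreserving.wellPosed (hS : S.IsEnergyPreserving) {T : ℝ → X →L[ℂ] X}
    (hT : IsC0Semigroup T) (hA : IsGeneratorOf S.restrictedOp T) (hTn : ∀ t x, ‖T t x‖ ≤ ‖x‖)
    (hTm : ∀ t, T t = T (max t 0)) (B : S.Lifting)
    (hB : ∀ u, S.opA ⟨B.op u, B.mem u⟩ = B.op u) : S.WellPosed := by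
  intro τ hτ
  refine ⟨1, one_pos, fun x₀ u hu hu0 => ?_⟩
  have hUD : UniqueDiffOn ℝ (Icc 0 τ) := uniqueDiffOn_Icc hτ
  set u' := derivWithin u (Icc 0 τ)
  have hu' : ContDiffOn ℝ 1 u' (Icc 0 τ) := hu.derivWithin hUD (by norm_num)
  have hud : ∀ t ∈ Icc 0 τ, HasDerivWithinAt u (u' t) (Icc 0 τ) t := fun t ht =>
    ((hu.differentiableOn two_ne_zero) t ht).hasDerivWithinAt
  have hu1 : ContDiffOn ℝ 1 u (Icc 0 τ) := hu.of_le (by norm_num)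
  obtain ⟨G, G', hG, hG', hGe⟩ := exists_hasDerivAt_eqOn hτ (hu1.sub hu')
  let BR : U →L[ℝ] X := B.op.restrictScalars ℝ
  have hv₀ : (x₀ : X) - B.op (u 0) ∈ S.restrictedOp.domain := by
    refine mem_restrictedOp_domain.2 ⟨S.opA.domain.sub_mem x₀.2 (B.mem _), ?_⟩
    have := S.opB.map_sub ⟨x₀, S.domain_le x₀.2⟩ ⟨B.op (u 0), S.domain_le (B.mem (u 0))⟩
    rw [B.right_inv, ← hu0, sub_self] at this
    exact this
  obtain ⟨v, v', hv0, hv'c, hv⟩ := hA.exists_solution hT hTn hTm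
    (F := fun t => B.op (G t)) (F' := fun t => B.op (G' t))
    (fun t => BR.hasFDerivAt.comp_hasDerivAt t (hG t)) (B.op.continuous.comp hG') ⟨_, hv₀⟩
  let x : ℝ → X := fun t => v t + B.op (u t)
  have hxd : ∀ t ∈ Icc 0 τ, HasDerivWithinAt x (v' t + B.op (u' t)) (Icc 0 τ) t := fun t ht =>
    ((hv t ht.1).1.mono Icc_subset_Ici_self).add
      (BR.hasFDerivAt.comp_hasDerivWithinAt t (hud t ht))
  have hmem : ∀ t ∈ Icc 0 τ, ∃ h : x t ∈ S.opA.domain,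
      S.opA ⟨x t, h⟩ = v' t + B.op (u' t) ∧ S.opB ⟨x t, S.domain_le h⟩ = u t := by
    intro t ht
    obtain ⟨w, hw1, hw2⟩ := (LinearPMap.mem_graph_iff _).1 (hv t ht.1).2
    simp only at hw1 hw2
    obtain ⟨h1, h2⟩ := mem_restrictedOp_domain.1 w.2
    rw [restrictedOp_apply] at hw2
    have e : x t = w + B.op (u t) := by rw [hw1]
    have hm : (w : X) + B.op (u t) ∈ S.opA.domain := S.opA.domain.add_mem h1 (B.mem _)
    have h3 := S.opA.map_add ⟨w, h1⟩ ⟨B.op (u t), B.mem _⟩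
    have h4 := S.opB.map_add ⟨w, S.domain_le h1⟩ ⟨B.op (u t), S.domain_le (B.mem _)⟩
    rw [h2, B.right_inv, zero_add] at h4
    rw [hB, hw2, hGe ht] at h3
    simp only [_root_.map_sub] at h3
    rw [show x t = _ from e]
    refine ⟨hm, h3.trans (by abel), h4⟩
  classical
  -- The default `0` is never taken on `[0, τ]`, where `x t` lies in the domain.
  let y : ℝ → Y := fun t => if h : x t ∈ S.opA.domain then S.opC ⟨x t, h⟩ else 0
  have hsol : S.IsClassicalSolution τ x₀ u x y := by
    refine ⟨by simp [x, hv0], ?_, fun t ht => ?_⟩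
    · rw [contDiffOn_one_iff_derivWithin hUD]
      refine ⟨fun t ht => (hxd t ht).differentiableWithinAt, ?_⟩
      exact (hv'c.continuousOn.add (B.op.continuous.comp_continuousOn hu'.continuousOn)).congr
        fun t ht => (hxd t ht).derivWithin (hUD t ht)
    · obtain ⟨h, h1, h2⟩ := hmem t ht
      exact ⟨h, h1 ▸ hxd t ht, h2, by simp only [y, dif_pos h]⟩
  obtain ⟨hi, he⟩ := hsol.norm_sq_add_integral hS hτ hu.continuousOn
  exact ⟨x, y, hsol, fun x' y' h' => h'.eqOn hS.energyBalance hτ hsol, hi, by rw [one_mul, he]⟩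

/-- The values of the transfer function are outputs of eigenvectors of `𝒜`. -/
theorem exists_transferFunction_eq (B : S.Lifting) (s : ℂ)
    (hs : s ∈ unboundedResolventSet S.restrictedOp) (u : U) :
    ∃ x : S.opA.domain, S.opA x = s • (x : X) ∧ S.transferFunction B s hs u = S.opC x := by
  have hR : IsResolventAt S.restrictedOp s (resolventAt S.restrictedOp s hs) := hs.choose_spec
  obtain ⟨h, he⟩ := hR.1 (S.opA ⟨B.op u, B.mem u⟩ - s • B.op u)
  rw [restrictedOp_apply] at he
  let w : S.opA.domain := ⟨resolventAt S.restrictedOp s hs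
    (S.opA ⟨B.op u, B.mem u⟩ - s • B.op u), S.restrictedOp_domain_le h⟩
  refine ⟨w + ⟨B.op u, B.mem u⟩, ?_, ?_⟩
  · rw [S.opA.map_add, Submodule.coe_add, smul_add]
    have he : s • (w : X) - S.opA w = S.opA ⟨B.op u, B.mem u⟩ - s • B.op u := he
    rw [sub_eq_sub_iff_add_eq_add] at he
    rw [he, add_comm]
  · rw [_root_.map_add]
    rfl

end BoundarySystem

/-! ### The diagonal system: assembling the components. -/

noncomputable section

namespace SignedDiagonal

open scoped InnerProductSpace

variable {p m : ℕ} {D : SignedDiagonal p m}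

/-- The sign of the diagonal entries: `1` for the `λ`'s and `-1` for the `θ`'s. -/
def entrySign (p m : ℕ) : Fin p ⊕ Fin m → ℝ := Sum.elim (fun _ => 1) fun _ => -1

theorem entrySign_mul_self (i : Fin p ⊕ Fin m) : entrySign p m i * entrySign p m i = 1 := by
  rcases i with k | j <;> simp [entrySign]

theorem abs_entry (i : Fin p ⊕ Fin m) (ξ : ℝ) (hξ : 0 ≤ ξ) :
    |D.entry i ξ| = entrySign p m i * D.entry i ξ := by
  rcases i with k | j
  · simpa [entrySign, entry] using (D.lam_pos k ξ hξ).le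
  · simpa [entrySign, entry] using (D.theta_neg j ξ hξ).le

theorem isRepresentative_iff {x z : D.State} {f : Fin p ⊕ Fin m → ℝ → ℂ} :
    D.IsRepresentative x f z ↔ ∀ i, IsWeightedRep (D.entry i) (x i) (f i) (z i) :=
  ⟨fun h i => ⟨h.absCont i, h.eq_mul i, h.hasDerivAt i⟩,
    fun h => ⟨fun i => (h i).absCont, fun i => (h i).eq_mul, fun i => (h i).hasDerivAt⟩⟩

theorem isWeightedRep_zero (i : Fin p ⊕ Fin m) : IsWeightedRep (D.entry i) 0 0 0 :=
  isRepresentative_iff.1 (IsRepresentative.zero (D := D)) i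

theorem mem_domain {x z : D.State} {f : Fin p ⊕ Fin m → ℝ → ℂ} (h : D.IsRepresentative x f z) :
    x ∈ D.system.opA.domain := ⟨f, z, h⟩

theorem opA_eq {x : D.system.opA.domain} {z : D.State} {f : Fin p ⊕ Fin m → ℝ → ℂ}
    (h : D.IsRepresentative x f z) : D.system.opA x = z :=
  (D.isRepresentative x).deriv_eq h

theorem opB_eq {x : D.system.opB.domain} {z : D.State} {f : Fin p ⊕ Fin m → ℝ → ℂ}
    (h : D.IsRepresentative x f z) (j : Fin m) : D.system.opB x j = f (Sum.inr j) 0 :=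
  (D.isRepresentative x).eqOn h _ self_mem_Ici

theorem opC_eq {x : D.system.opA.domain} {z : D.State} {f : Fin p ⊕ Fin m → ℝ → ℂ}
    (h : D.IsRepresentative x f z) (k : Fin p) : D.system.opC x k = f (Sum.inl k) 0 :=
  (D.isRepresentative x).eqOn h _ self_mem_Ici

section Bounded

variable (hbdd : ∃ M : ℝ, ∀ i, ∀ ξ : ℝ, 0 ≤ ξ → |D.entry i ξ| ≤ M)
include hbdd

theorem two_mul_re_inner_entry {x z : D.State} {f : Fin p ⊕ Fin m → ℝ → ℂ}
    (h : D.IsRepresentative x f z) (i : Fin p ⊕ Fin m) :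
    2 * (⟪x i, z i⟫_ℂ).re = -(entrySign p m i * ‖f i 0‖ ^ 2) := by
  obtain ⟨M, hM⟩ := hbdd
  exact (isRepresentative_iff.1 h i).two_mul_re_inner (D.entry_continuousOn i)
    (entrySign_mul_self i) (abs_entry i) (hM i)

/-- Summing the component identities, the negative entries contribute the input energy and the
positive ones minus the output energy. -/
theorem isEnergyPreserving : D.system.IsEnergyPreserving := by
  intro x
  have h := D.isRepresentative x
  have hA : D.system.opA x = D.derivative x := rfl
  have hB : ∀ j, D.system.opB ⟨x, D.system.domain_le x.2⟩ j = D.rep x (Sum.inr j) 0 := opB_eq h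
  rw [hA, PiLp.inner_apply, Complex.re_sum, Finset.mul_sum, EuclideanSpace.norm_sq_eq,
    EuclideanSpace.norm_sq_eq, Finset.sum_congr rfl fun i _ => two_mul_re_inner_entry hbdd h i,
    Fintype.sum_sum_type]
  simp only [entrySign, Sum.elim_inl, Sum.elim_inr, opC_eq h, hB]
  simp
  ring

end Bounded

/-- The equation decouples, and the conditions `f(0) = 0` in the components with `σ = -1` say
exactly that the solution lies in `ker ℬ`. -/
theorem exists_resolvent_eq {s : ℂ} (hs : 0 < s.re) (y : D.State) :
    ∃ x : D.system.restrictedOp.domain, s • (x : D.State) - D.system.restrictedOp x = y := by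
  choose x f hf hf0 using fun i => exists_isWeightedRep_resolvent (D.entry_continuousOn i)
    (D.entry_ne_zero i) (entrySign_mul_self i) (abs_entry i) hs (y i)
  have hrep : D.IsRepresentative (WithLp.toLp 2 x) f (s • WithLp.toLp 2 x - y) :=
    isRepresentative_iff.2 hf
  have hB : D.system.opB ⟨WithLp.toLp 2 x, mem_domain hrep⟩ = 0 := by
    ext j
    rw [opB_eq hrep]
    exact hf0 _ rfl
  refine ⟨⟨WithLp.toLp 2 x, BoundarySystem.mem_restrictedOp_domain.2 ⟨mem_domain hrep, hB⟩⟩, ?_⟩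
  rw [BoundarySystem.restrictedOp_apply, opA_eq hrep]
  exact sub_sub_cancel _ _

/-- A lifting whose values are fixed by `𝒜`. -/
theorem exists_lifting : ∃ B : D.system.Lifting, ∀ u,
    D.system.opA ⟨B.op u, B.mem u⟩ = B.op u := by
  -- For `σ = -1` and `c = 1` the eigenvalue `-cσ` is `1`, so `𝒜` fixes these vectors. The
  -- normalisation `f 0 = 1` makes the lifting a right inverse of `ℬ`.
  choose e f hf hf0 using fun j : Fin m => exists_isWeightedRep_eigen (c := 1)
    (D.entry_continuousOn (Sum.inr j)) (D.entry_ne_zero (Sum.inr j))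
    (entrySign_mul_self (Sum.inr j)) (abs_entry (Sum.inr j)) (by simp)
  let L : EuclideanSpace ℂ (Fin m) →ₗ[ℂ] D.State :=
    { toFun := fun u => WithLp.toLp 2 (Sum.rec (fun _ => 0) fun j => u j • e j)
      map_add' := fun u v => by
        ext i : 1
        rcases i with k | j
        · exact (add_zero _).symm
        · exact add_smul _ _ _
      map_smul' := fun c u => by
        ext i : 1
        rcases i with k | j
        · exact (smul_zero c).symm
        · exact mul_smul _ _ _ }
  let F : EuclideanSpace ℂ (Fin m) → Fin p ⊕ Fin m → ℝ → ℂ :=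
    fun u => Sum.elim (fun _ => 0) fun j => u j • f j
  have hrep : ∀ u, D.IsRepresentative (L u) (F u) (L u) := by
    intro u
    rw [isRepresentative_iff]
    rintro (k | j)
    · exact isWeightedRep_zero _
    · have h1 := (hf j)
      have h2 : (-((1 : ℂ) * (entrySign p m (Sum.inr j) : ℝ))) • e j = e j := by
        simp [entrySign]
      rw [h2] at h1
      exact h1.smul (D.entry_continuousOn _) (D.entry_ne_zero _) (u j)
  refine ⟨⟨LinearMap.toContinuousLinearMap L, fun u => mem_domain (hrep u), ?_, fun u => ?_⟩,
    fun u => opA_eq (hrep u)⟩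
  · refine ⟨‖LinearMap.toContinuousLinearMap L‖, fun u => ?_⟩
    have := opA_eq (x := ⟨_, mem_domain (hrep u)⟩) (hrep u)
    exact (congrArg norm this).le.trans ((LinearMap.toContinuousLinearMap L).le_opNorm u)
  · ext j
    refine (opB_eq (hrep u) j).trans ?_
    simp [F, hf0]

/-- An eigenvector of `A` for an eigenvalue in the left half-plane. -/
theorem exists_eigenvector (k : Fin p) {s : ℂ} (hs : s.re < 0) :
    ∃ x : D.system.restrictedOp.domain, (x : D.State) ≠ 0 ∧
      D.system.restrictedOp x = s • (x : D.State) := by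
  -- For `σ = 1` and `c = -s` the eigenvalue `-cσ` is `s`. A vector supported in one positive
  -- component has zero input, so it lies in `D(A)`.
  obtain ⟨e, f, hf, hf0⟩ := exists_isWeightedRep_eigen (c := -s)
    (D.entry_continuousOn (Sum.inl k)) (D.entry_ne_zero (Sum.inl k))
    (entrySign_mul_self (Sum.inl k)) (abs_entry (Sum.inl k)) (by simpa using hs)
  have h2 : (-(-s * (entrySign p m (Sum.inl k) : ℝ))) • e = s • e := by simp [entrySign]
  rw [h2] at hf
  let x : D.State := WithLp.toLp 2 (Pi.single (Sum.inl k) e)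
  have hxk : x (Sum.inl k) = e := by simp [x]
  have hxi : ∀ i, i ≠ Sum.inl k → x i = 0 := fun i hi => by simp [x, hi]
  have hrep : D.IsRepresentative x (Pi.single (Sum.inl k) f) (s • x) := by
    rw [isRepresentative_iff]
    intro i
    rw [PiLp.smul_apply]
    by_cases hi : i = Sum.inl k
    · subst hi
      rw [hxk, Pi.single_eq_same]
      exact hf
    · rw [hxi i hi, Pi.single_eq_of_ne hi, smul_zero]
      exact isWeightedRep_zero i
  have hB : D.system.opB ⟨x, mem_domain hrep⟩ = 0 := by
    ext j
    rw [opB_eq hrep, Pi.single_eq_of_ne (by simp)]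
    rfl
  refine ⟨⟨x, BoundarySystem.mem_restrictedOp_domain.2 ⟨mem_domain hrep, hB⟩⟩, fun h => ?_, ?_⟩
  · have h0 : x = 0 := h
    rw [h0, smul_zero] at hrep
    have := hrep.eqOn IsRepresentative.zero (Sum.inl k) (self_mem_Ici (a := (0 : ℝ)))
    simp [hf0] at this
  · rw [BoundarySystem.restrictedOp_apply]
    exact opA_eq hrep

/-- The energy identity is applied in each positive component separately: the summed identity also
contains the input energy `‖u‖²`, which need not vanish. -/
theorem transferFunction_eq_zero
    (hbdd : ∃ M : ℝ, ∀ i, ∀ ξ : ℝ, 0 ≤ ξ → |D.entry i ξ| ≤ M) (B : D.system.Lifting) (s : ℂ)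
    (hs : s ∈ unboundedResolventSet D.system.restrictedOp) (u : EuclideanSpace ℂ (Fin m)) :
    D.system.transferFunction B s hs u = 0 := by
  obtain ⟨x, hx, hG⟩ := BoundarySystem.exists_transferFunction_eq B s hs u
  rw [hG]
  ext k
  -- Since `s - A` is injective for `s ∈ ρ(A)`, the eigenvectors for `Re s < 0` exclude the open
  -- left half-plane.
  have hre : 0 ≤ s.re := by
    by_contra hneg
    obtain ⟨v, hv0, hv⟩ := exists_eigenvector (D := D) k (not_le.1 hneg)
    obtain ⟨R, hR⟩ := hs
    have := hR.2 v
    rw [hv, sub_self, map_zero] at this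
    exact hv0 this.symm
  have hrep := D.isRepresentative x
  have hz : D.derivative x = s • (x : D.State) := hx
  have h1 := two_mul_re_inner_entry hbdd hrep (Sum.inl k)
  rw [hz, PiLp.smul_apply, inner_smul_right, inner_self_eq_norm_sq_to_K] at h1
  simp only [Complex.coe_algebraMap, ← Complex.ofReal_pow, Complex.re_mul_ofReal, entrySign,
    Sum.elim_inl, one_mul] at h1
  have h2 : 0 ≤ s.re * ‖(x : D.State) (Sum.inl k)‖ ^ 2 := by positivity
  have h3 : ‖D.rep x (Sum.inl k) 0‖ = 0 := by
    nlinarith [norm_nonneg (D.rep x (Sum.inl k) 0)]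
  rw [opC_eq hrep]
  exact norm_eq_zero.1 h3

end SignedDiagonal

end

theorem lemma4p7 {p m : ℕ} (hp : 1 ≤ p) (hm : 1 ≤ m) (D : SignedDiagonal p m)
    (hbdd : ∃ M : ℝ, ∀ i, ∀ ξ : ℝ, 0 ≤ ξ → |D.entry i ξ| ≤ M) :
    D.system.IsBoundaryControlSystem ∧
    D.system.WellPosed ∧
    D.system.EnergyBalance ∧
    (∀ s : ℂ, 0 < s.re → s ∈ unboundedResolventSet D.system.restrictedOp) ∧
    (∀ (B : D.system.Lifting) (s : ℂ) (hs : s ∈ unboundedResolventSet D.system.restrictedOp)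
      (u : EuclideanSpace ℂ (Fin m)), D.system.transferFunction B s hs u = 0) := by
  have hE := D.isEnergyPreserving hbdd
  have hdiss : ∀ x : D.system.restrictedOp.domain,
      (inner ℂ (x : D.State) (D.system.restrictedOp x)).re ≤ 0 := fun x => by
    have := hE.dissipative x
    nlinarith [sq_nonneg ‖D.system.opC ⟨x, D.system.restrictedOp_domain_le x.2⟩‖]
  obtain ⟨T, hT, hA, hTn, hTm⟩ := exists_contraction_semigroup hdiss fun s hs y =>
    SignedDiagonal.exists_resolvent_eq (by rwa [Complex.ofReal_re]) y
  obtain ⟨B, hB⟩ := D.exists_lifting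
  refine ⟨⟨⟨T, hT, hA⟩, ⟨B⟩, 1, hE.output_bounded⟩, hE.wellPosed hT hA hTn hTm B hB,
    hE.energyBalance, fun s hs => ?_, SignedDiagonal.transferFunction_eq_zero hbdd⟩
  obtain ⟨R, hR, -⟩ := exists_isResolventAt_of_dissipative hdiss hs
    (SignedDiagonal.exists_resolvent_eq hs)
  exact ⟨R, hR⟩
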